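/- Let $n\in\mathbb N$, let $(\Omega_j,\Sigma_j,\mu_j)$, $1\le j\le n$, be $\sigma$-finite measure spaces with product $(\Omega,\Sigma,\mu)$, and for $z\in\{0,1\}$ let $\varphi_{zj}$ be a probability density with respect to $\mu_j$ (a probability mass function when $\mu_j$ is a counting measure). Put $\varphi_z(x)=\prod_{j=1}^n\varphi_{zj}(x_j)$, and assume that the Kullback–Leibler divergences $\int\varphi_0\log\frac{\varphi_0}{\varphi_1}\,d\mu$ and $\int\varphi_1\log\frac{\varphi_1}{\varphi_0}\,d\mu$ are both positive and finite (in particular the two laws are mutually absolutely continuous). For $\alpha\in(0,1)$ let $D_\alpha=-\log\int_\Omega\varphi_0^{1-\alpha}\varphi_1^{\alpha}\,d\mu$ be the Chernoff $\alpha$-divergence and $D^*=\sup_{\alpha\in(0,1)}D_\alpha$ the Chernoff information; let $\varphi_\alpha=\varphi_0^{1-\alpha}\varphi_1^{\alpha}e^{D_\alpha}$ and $\varphi_{\alpha j}=\varphi_{0j}^{1-\alpha}\varphi_{1j}^{\alpha}\big/\int_{\Omega_j}\varphi_{0j}^{1-\alpha}\varphi_{1j}^{\alpha}\,d\mu_j$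 be the tilted densities, $l=\varphi_0/\varphi_1$, $l_j=\varphi_{0j}/\varphi_{1j}$, and $g_\alpha(x)=\exp[\min(\alpha x,(\alpha-1)x)]$. Let $\eta(\varphi_0,\varphi_1)=\int_\Omega\min(\varphi_0,\varphi_1)\,d\mu$ be the total variation affinity. Then $\alpha\mapsto D_\alpha$ has a unique maximiser $\alpha^*$ in $(0,1)$, and $\eta(\varphi_0,\varphi_1)=2R(\hat z,z)$ for every Bayes estimator $\hat z$ (a measurable choice of $\hat z(x)\in\arg\max_{z}\varphi_z(x)$), where $R(\hat z,z)=\frac12\sum_{z\in\{0,1\}}\mathbb P_{X\sim\varphi_z}(\hat z(X)\neq z)$. Let $Y_j\sim\varphi_{\alpha^*j}$, $$Z_j=\log l_j(Y_j)-\mathbb E[\log l_j(Y_j)],\qquad \bar\sigma_n=\Big(\frac1n\sum_{j=1}^n\operatorname{Var}[Z_j]\Big)^{1/2}.$$ For every $C_1$ there are positive constants $C_2,C_3,C_4$, depending only on $C_1$, such that whenever $\sum_{j=1}^n\mathbb E|Z_j|^3\le C_1n\bar\sigma_n^2$, the following hold. 1. (Upper bound) $$\mathbb E_{Y\sim\varphi_{\alpha^*}}[g_{\alpha^*}(\log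 l(Y))]\le\frac{C_2}{\sqrt n\,\bar\sigma_n\alpha^*(1-\alpha^*)},\qquad \eta(\varphi_0,\varphi_1)\le\frac{C_2}{\sqrt n\,\bar\sigma_n\alpha^*(1-\alpha^*)}\,e^{-D^*}.$$ 2. (Lower bound) If $\sqrt n\,\bar\sigma_n\alpha^*(1-\alpha^*)\ge C_3$, then $$\mathbb E_{Y\sim\varphi_{\alpha^*}}[g_{\alpha^*}(\log l(Y))]\ge\frac{C_4}{\sqrt n\,\bar\sigma_n\alpha^*(1-\alpha^*)},\qquad \eta(\varphi_0,\varphi_1)\ge\frac{C_4}{\sqrt n\,\bar\sigma_n\alpha^*(1-\alpha^*)}\,e^{-D^*}.$$ Since $\eta(\varphi_0,\varphi_1)=2R(\hat z,z)$, the same bounds hold for $2R(\hat z,z)$. -/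

import Mathlib

open MeasureTheory

noncomputable section

namespace BayesChernoff

section General

variable {X : Type*} [MeasurableSpace X]

/-- `f` is a probability density with respect to `μ`; a probability mass function is a density
with respect to a counting measure. -/
structure IsDensity (μ : Measure X) (f : X → ℝ) : Prop where
  measurable : Measurable f
  nonneg : ∀ x, 0 ≤ f x
  lintegral_eq_one : ∫⁻ x, ENNReal.ofReal (f x) ∂μ = 1

/-- The measure with density `f` with respect to `μ`. -/
def law (μ : Measure X) (f : X → ℝ) : Measure X :=
  μ.withDensity fun x => ENNReal.ofReal (f x)

/-- The Chernoff `α`-divergence `D_α(f ‖ g) = -log ∫ f ^ (1 - α) g ^ α dμ`. -/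
def chernoffDiv (μ : Measure X) (f g : X → ℝ) (α : ℝ) : ℝ :=
  -Real.log (∫ x, f x ^ (1 - α) * g x ^ α ∂μ)

/-- The Chernoff information, the supremum over `α ∈ (0, 1)` of the Chernoff `α`-divergence. -/
def chernoffInfo (μ : Measure X) (f g : X → ℝ) : ℝ :=
  sSup (chernoffDiv μ f g '' Set.Ioo 0 1)

/-- `α` is a maximiser over the open interval `(0, 1)` of the Chernoff `α`-divergence. -/
def IsChernoffArgmax (μ : Measure X) (f g : X → ℝ) (α : ℝ) : Prop :=
  α ∈ Set.Ioo (0 : ℝ) 1 ∧ IsMaxOn (chernoffDiv μ f g) (Set.Ioo 0 1) α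

/-- The tilted density `f ^ (1 - α) g ^ α exp (D_α(f ‖ g))`. -/
def tilted (μ : Measure X) (f g : X → ℝ) (α : ℝ) (x : X) : ℝ :=
  f x ^ (1 - α) * g x ^ α * Real.exp (chernoffDiv μ f g α)

/-- The log-likelihood ratio `log (f / g)`. -/
def logLR (f g : X → ℝ) (x : X) : ℝ :=
  Real.log (f x / g x)

/-- The log-likelihood ratio centred at its mean under the tilted law. -/
def centredLLR (μ : Measure X) (f g : X → ℝ) (α : ℝ) (x : X) : ℝ :=
  logLR f g x - ∫ y, logLR f g y ∂(law μ (tilted μ f g α))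

/-- The total variation affinity `∫ min (f, g) dμ`. -/
def affinity (μ : Measure X) (f g : X → ℝ) : ℝ :=
  ∫ x, min (f x) (g x) ∂μ

/-- A Bayes estimator for two equiprobable hypotheses: a measurable choice of
`argmax_z φ z x`, with an arbitrary rule for ties. -/
def IsBayesEstimator (φ : Fin 2 → X → ℝ) (zhat : X → Fin 2) : Prop :=
  Measurable zhat ∧ ∀ x z, φ z x ≤ φ (zhat x) x

/-- The error probability of `zhat`, averaged over the two hypotheses. -/
def errorProb (μ : Measure X) (φ : Fin 2 → X → ℝ) (zhat : X → Fin 2) : ℝ :=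
  (1 / 2) * ∑ z : Fin 2, (law μ (φ z)).real {x | zhat x ≠ z}

end General

/-- `g_α(x) = exp (min (α x, (α - 1) x))`. -/
def gFun (α x : ℝ) : ℝ :=
  Real.exp (min (α * x) ((α - 1) * x))

section Product

variable {n : ℕ} {Ω : Fin n → Type*}

/-- The product density `φ_z(x) = ∏ j, φ_{z j}(x_j)`. -/
def prodDensity (φ : Fin 2 → (j : Fin n) → Ω j → ℝ) (z : Fin 2) (x : (j : Fin n) → Ω j) : ℝ :=
  ∏ j, φ z j (x j)

variable [∀ j, MeasurableSpace (Ω j)]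

/-- The pairs of product densities under consideration: all the factors are probability
densities, and both Kullback-Leibler divergences between the two product laws are positive
real numbers. -/
structure InFamily (μ : (j : Fin n) → Measure (Ω j))
    (φ : Fin 2 → (j : Fin n) → Ω j → ℝ) : Prop where
  isDensity : ∀ z j, IsDensity (μ j) (φ z j)
  kl_pos : ∀ z w : Fin 2, z ≠ w →
    0 < InformationTheory.klDiv (law (Measure.pi μ) (prodDensity φ z))
      (law (Measure.pi μ) (prodDensity φ w))
  kl_lt_top : ∀ z w : Fin 2, z ≠ w →
    InformationTheory.klDiv (law (Measure.pi μ) (prodDensity φ z))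
      (law (Measure.pi μ) (prodDensity φ w)) < ⊤

/-- The law `φ_{α j}` of `Y_j`. -/
def coordLaw (μ : (j : Fin n) → Measure (Ω j)) (φ : Fin 2 → (j : Fin n) → Ω j → ℝ) (α : ℝ)
    (j : Fin n) : Measure (Ω j) :=
  law (μ j) (tilted (μ j) (φ 0 j) (φ 1 j) α)

/-- `Z_j`, as a function of the value of `Y_j`. -/
def coordZ (μ : (j : Fin n) → Measure (Ω j)) (φ : Fin 2 → (j : Fin n) → Ω j → ℝ) (α : ℝ)
    (j : Fin n) : Ω j → ℝ :=
  centredLLR (μ j) (φ 0 j) (φ 1 j) α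

/-- `σ̄_n`, the square root of the average variance of the `Z_j`. -/
def sigmaBar (μ : (j : Fin n) → Measure (Ω j)) (φ : Fin 2 → (j : Fin n) → Ω j → ℝ)
    (α : ℝ) : ℝ :=
  Real.sqrt ((1 / (n : ℝ)) *
    ∑ j, ProbabilityTheory.variance (coordZ μ φ α j) (coordLaw μ φ α j))

/-- `E_{Y ∼ φ_α} [g_α(log l(Y))]`, with `l = φ_0 / φ_1` on the product space. -/
def expG (μ : (j : Fin n) → Measure (Ω j)) (φ : Fin 2 → (j : Fin n) → Ω j → ℝ)
    (α : ℝ) : ℝ :=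
  ∫ y, gFun α (logLR (prodDensity φ 0) (prodDensity φ 1) y)
    ∂(law (Measure.pi μ) (tilted (Measure.pi μ) (prodDensity φ 0) (prodDensity φ 1) α))

end Product

end BayesChernoff

end

open MeasureTheory BayesChernoff

open MeasureTheory

/-! Write L = log l. Pointwise min(φ₀, φ₁) = φ_α e^{-D_α} g_α(L), so the affinity is E[g_α(L(Y))]
e^{-D_α} with Y ∼ φ_α (`IsEquivPair.affinity_eq`). The integral of φ₀^{1-α} φ₁^α is the moment
generating function of -L under φ₀. It is strictly convex on [0, 1] and equals 1 at both ends, so it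
has a unique minimiser α* in the interior, and the vanishing derivative there says that L(Y) has
mean 0. Tilting respects products, so L(Y) is a sum S of the independent centred Z_j, with variance
s² = n σ̄² and total third moment at most C s².

What remains is a local limit estimate: near 0, S gives mass of order H/s to intervals of length H,
for H between a constant and a small multiple of s. Since g_α has integral 1/(α(1-α)), its
expectation is of order 1/(s α(1-α)).

The third moments control the characteristic function χ of S: |χ(u)| ≤ e^{-s²u²/4} for 0 ≤ u ≤
1/(16C), and |χ(u) - e^{-s²u²/2}| ≤ 5C s²u³ (`norm_charFun_map_sum_le`,
`norm_charFun_map_sum_sub_le`). The Fejér kernel has compactly supported Fourier transform, so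
expectations of its dilates only see χ in that range. Two translates of the kernel dominate
e^{-|x|}, hence g_α, which gives the upper bound (`integral_gFun_le`). A narrow kernel minus a small
multiple of the two translates lies below the indicator of an interval, which gives the lower bound
(`le_measureReal_interval`, `le_integral_gFun`). -/

namespace BayesChernoff

/-! ### Pointwise estimates for the Fejér kernel. -/

/-- The Fejér kernel, the Fourier transform of the triangle function. -/
noncomputable def fejer (x : ℝ) : ℝ := 2 * ∫ t in (0 : ℝ)..1, (1 - t) * Real.cos (t * x)

theorem sq_mul_fejer (x : ℝ) : x ^ 2 * fejer x = 2 * (1 - Real.cos x) := by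
  rcases eq_or_ne x 0 with rfl | hx
  · simp
  have h : ∀ t ∈ Set.uIcc (0 : ℝ) 1, HasDerivAt
      (fun t => (1 - t) * (Real.sin (t * x) / x) - Real.cos (t * x) / x ^ 2)
      ((1 - t) * Real.cos (t * x)) t := by
    intro t _
    have h0 : HasDerivAt (fun t : ℝ => t * x) x t := by simpa using (hasDerivAt_id t).mul_const x
    have h1 : HasDerivAt (fun t : ℝ => 1 - t) (-1) t := by
      simpa using (hasDerivAt_id t).const_sub 1
    refine ((h1.mul (h0.sin.div_const x)).sub (h0.cos.div_const (x ^ 2))).congr_deriv ?_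
    field_simp
    ring
  rw [fejer, intervalIntegral.integral_eq_sub_of_hasDerivAt h
    (Continuous.intervalIntegrable (by fun_prop) _ _)]
  simp
  field_simp
  ring

theorem fejer_zero : fejer 0 = 1 := by
  have : ∫ t in (0 : ℝ)..1, (1 - t) = 1 / 2 := by
    rw [intervalIntegral.integral_sub (by simp) (by simp)]
    norm_num
  simp [fejer, this]

theorem fejer_nonneg (x : ℝ) : 0 ≤ fejer x := by
  rcases eq_or_ne x 0 with rfl | hx
  · simp [fejer_zero]
  · have h : 0 < x ^ 2 := by positivity
    by_contra! h'
    nlinarith [sq_mul_fejer x, Real.cos_le_one x]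

theorem fejer_le_one (x : ℝ) : fejer x ≤ 1 := by
  rcases eq_or_ne x 0 with rfl | hx
  · simp [fejer_zero]
  · have h : 0 < x ^ 2 := by positivity
    by_contra! h'
    nlinarith [sq_mul_fejer x, Real.one_sub_sq_div_two_le_cos (x := x)]

/-- The sum of two translates of the Fejér kernel has no zeros. -/
theorem four_le_mul_fejer_add_fejer (x : ℝ) :
    4 ≤ (|x| + Real.pi) ^ 2 * (fejer x + fejer (x + Real.pi)) := by
  have h1 := sq_mul_fejer x
  have h2 := sq_mul_fejer (x + Real.pi)
  -- The numerators 2(1 - cos x) and 2(1 + cos x) add up to 4.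
  rw [Real.cos_add_pi] at h2
  have hp := Real.pi_pos
  have a1 : x ^ 2 ≤ (|x| + Real.pi) ^ 2 := by
    rw [← sq_abs x]; gcongr; linarith
  have a2 : (x + Real.pi) ^ 2 ≤ (|x| + Real.pi) ^ 2 := by
    apply sq_le_sq'
    · linarith [neg_abs_le x]
    · linarith [le_abs_self x]
  nlinarith [mul_le_mul_of_nonneg_right a1 (fejer_nonneg x),
    mul_le_mul_of_nonneg_right a2 (fejer_nonneg (x + Real.pi))]

theorem exp_neg_abs_le_fejer (x : ℝ) :
    Real.exp (-|x|) ≤ 4 * (fejer x + fejer (x + Real.pi)) := by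
  have h := four_le_mul_fejer_add_fejer x
  have hy := abs_nonneg x
  have he : (|x| + Real.pi) ^ 2 ≤ 16 * Real.exp |x| := by
    have := Real.quadratic_le_exp_of_nonneg hy
    nlinarith [Real.pi_lt_four, Real.pi_pos]
  have hF : 0 ≤ fejer x + fejer (x + Real.pi) := add_nonneg (fejer_nonneg _) (fejer_nonneg _)
  rw [Real.exp_neg, inv_le_iff_one_le_mul₀ (Real.exp_pos _)]
  nlinarith [mul_le_mul_of_nonneg_right he hF]

/-- A band-limited minorant of an indicator. For |y| > 1 the narrow kernel is at most 4/(My)², which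
the two translates, having no common zero, dominate. -/
theorem fejer_sub_le_indicator {M : ℝ} (hM : 0 < M) (y : ℝ) :
    fejer (M * y) - 18 / M ^ 2 * (fejer y + fejer (y + Real.pi))
      ≤ Set.indicator {y : ℝ | |y| ≤ 1} 1 y := by
  have hF : 0 ≤ fejer y + fejer (y + Real.pi) := add_nonneg (fejer_nonneg _) (fejer_nonneg _)
  have hMp : 0 < M ^ 2 := by positivity
  by_cases hy : |y| ≤ 1
  · rw [Set.indicator_of_mem (by exact hy)]
    have : 0 ≤ 18 / M ^ 2 * (fejer y + fejer (y + Real.pi)) := by positivity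
    have := fejer_le_one (M * y)
    simp only [Pi.one_apply]
    linarith
  · rw [Set.indicator_of_notMem (by exact hy)]
    push Not at hy
    have h4 := four_le_mul_fejer_add_fejer y
    have h5 := sq_mul_fejer (M * y)
    have h6 := Real.neg_one_le_cos (M * y)
    -- Here |y| > 1, and 18 exceeds (1 + π)².
    have h7 : (|y| + Real.pi) ^ 2 ≤ 18 * y ^ 2 := by
      rw [← sq_abs y]
      nlinarith [Real.pi_lt_d2, Real.pi_pos]
    have hy2 : 0 < y ^ 2 := by
      rw [← sq_abs y]; positivity
    have h8 : M ^ 2 * y ^ 2 * fejer (M * y)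
        ≤ y ^ 2 * (18 * (fejer y + fejer (y + Real.pi))) := by
      nlinarith [mul_le_mul_of_nonneg_right h7 hF]
    have h9 : M ^ 2 * fejer (M * y) ≤ 18 * (fejer y + fejer (y + Real.pi)) := by
      by_contra! h'
      nlinarith [mul_lt_mul_of_pos_left h' hy2]
    have : fejer (M * y) ≤ 18 / M ^ 2 * (fejer y + fejer (y + Real.pi)) := by
      rw [div_mul_eq_mul_div, le_div_iff₀ hMp]
      linarith
    linarith

theorem continuous_fejer : Continuous fejer := by
  unfold fejer
  refine continuous_const.mul ?_
  exact intervalIntegral.continuous_parametric_intervalIntegral_of_continuous' (by fun_prop) _ _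

/-! ### Smoothed expectations from bounds on the characteristic function. -/

section CharFun

variable {ν : Measure ℝ} [IsProbabilityMeasure ν]

theorem integrable_fejer (T b : ℝ) : Integrable (fun x => fejer (T * x + b)) ν := by
  have := continuous_fejer
  refine Integrable.of_bound (C := 1) (by fun_prop) (ae_of_all _ fun x => ?_)
  rw [Real.norm_of_nonneg (fejer_nonneg _)]
  exact fejer_le_one _

theorem integral_cos_eq_re_charFun (u b : ℝ) :
    ∫ x, Real.cos (u * x + b) ∂ν = (Complex.exp (b * Complex.I) * charFun ν u).re := by
  rw [charFun_apply_real, ← integral_const_mul, ← RCLike.re_eq_complex_re, ← integral_re]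
  · refine integral_congr_ae (ae_of_all _ fun x => ?_)
    simp only [RCLike.re_eq_complex_re]
    rw [← Complex.exp_add, ← add_mul, ← Complex.ofReal_mul, ← Complex.ofReal_add,
      Complex.exp_ofReal_mul_I_re, add_comm]
  · refine Integrable.of_bound (C := 1) (by fun_prop) (ae_of_all _ fun x => ?_)
    rw [norm_mul, Complex.norm_exp_ofReal_mul_I, ← Complex.ofReal_mul,
      Complex.norm_exp_ofReal_mul_I, one_mul]

/-- Fubini. For T ≥ 0 only the frequencies in [0, T] enter. -/
theorem integral_fejer_eq (T b : ℝ) :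
    ∫ x, fejer (T * x + b) ∂ν = 2 * ∫ t in (0 : ℝ)..1,
      (1 - t) * (Complex.exp (↑(t * b) * Complex.I) * charFun ν (t * T)).re := by
  simp only [fejer]
  rw [integral_const_mul]
  congr 1
  simp_rw [intervalIntegral.integral_of_le (zero_le_one' ℝ)]
  rw [integral_integral_swap]
  · refine integral_congr_ae (ae_of_all _ fun t => ?_)
    simp only
    rw [integral_const_mul, ← integral_cos_eq_re_charFun]
    congr 1
    refine integral_congr_ae (ae_of_all _ fun x => ?_)
    simp only
    ring_nf
  · refine Integrable.of_bound (C := 1) (Continuous.aestronglyMeasurable (by fun_prop)) ?_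
    have : ∀ᵐ z : ℝ × ℝ ∂(ν.prod (volume.restrict (Set.Ioc (0:ℝ) 1))), z.2 ∈ Set.Ioc (0:ℝ) 1 := by
      apply Measure.quasiMeasurePreserving_snd.ae
      exact ae_restrict_mem measurableSet_Ioc
    filter_upwards [this] with z hz
    simp only [Function.uncurry]
    rw [norm_mul, Real.norm_eq_abs, Real.norm_eq_abs, abs_of_nonneg (by linarith [hz.2])]
    have := Real.abs_cos_le_one (z.2 * (T * z.1 + b))
    have := abs_nonneg (Real.cos (z.2 * (T * z.1 + b)))
    nlinarith [hz.1, hz.2]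

theorem continuous_fejer_integrand (T b : ℝ) : Continuous fun t : ℝ =>
    (1 - t) * (Complex.exp (↑(t * b) * Complex.I) * charFun ν (t * T)).re := by
  have h : Continuous (charFun ν) := continuous_charFun
  fun_prop

theorem abs_re_exp_mul_le (b : ℝ) (z : ℂ) :
    |(Complex.exp (b * Complex.I) * z).re| ≤ ‖z‖ := by
  refine (Complex.abs_re_le_norm _).trans ?_
  rw [norm_mul, Complex.norm_exp_ofReal_mul_I, one_mul]

/-- A Gaussian bound on the characteristic function bounds the mass near every point. -/
theorem integral_fejer_le {s T₀ T : ℝ} (hs : 0 < s) (hT : 0 < T) (hTT : T ≤ T₀)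
    (hν : ∀ u, 0 ≤ u → u ≤ T₀ → ‖charFun ν u‖ ≤ Real.exp (-(s ^ 2 * u ^ 2 / 4))) (b : ℝ) :
    ∫ x, fejer (T * x + b) ∂ν ≤ 4 / (s * T) := by
  have key : ∫ t in (0 : ℝ)..1,
      (1 - t) * (Complex.exp (↑(t * b) * Complex.I) * charFun ν (t * T)).re
      ≤ ∫ t in (0 : ℝ)..1, Real.exp (-(s ^ 2 * T ^ 2 / 4) * t ^ 2) := by
    refine intervalIntegral.integral_mono_on zero_le_one
      ((continuous_fejer_integrand T b).intervalIntegrable _ _)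
      (Continuous.intervalIntegrable (by fun_prop) _ _) fun t ht => ?_
    have h1 := (le_abs_self _).trans (abs_re_exp_mul_le (t * b) (charFun ν (t * T)))
    have h2 := hν (t * T) (mul_nonneg ht.1 hT.le) (by nlinarith [ht.1, ht.2])
    have h3 : -(s ^ 2 * (t * T) ^ 2 / 4) = -(s ^ 2 * T ^ 2 / 4) * t ^ 2 := by ring
    rw [h3] at h2
    nlinarith [ht.1, ht.2, Real.exp_pos (-(s ^ 2 * T ^ 2 / 4) * t ^ 2)]
  have hb : 0 < s ^ 2 * T ^ 2 / 4 := by positivity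
  have hle : ∫ t in (0 : ℝ)..1, Real.exp (-(s ^ 2 * T ^ 2 / 4) * t ^ 2)
      ≤ √(Real.pi / (s ^ 2 * T ^ 2 / 4)) / 2 := by
    rw [← integral_gaussian_Ioi, intervalIntegral.integral_of_le zero_le_one]
    exact setIntegral_mono_set (integrable_exp_neg_mul_sq hb).integrableOn
      (ae_of_all _ fun t => (Real.exp_pos _).le) Set.Ioc_subset_Ioi_self.eventuallyLE
  have hsq : √(Real.pi / (s ^ 2 * T ^ 2 / 4)) ≤ 4 / (s * T) := by
    rw [Real.sqrt_le_left (by positivity)]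
    rw [div_pow, div_le_div_iff₀ hb (by positivity)]
    nlinarith [Real.pi_lt_four, show 0 < s ^ 2 * T ^ 2 by positivity]
  rw [integral_fejer_eq]
  linarith

/-- With a = sT, the integrand is close to (1 - t) cos(tb) e^{-(at)²/2}. The interval [0, 1/a]
contributes at least 0.145/a, [1/a, 4/a] loses at most 0.03/a and [4/a, 1] at most 0.025/a; twice
the balance exceeds 1/(10a). -/
theorem integral_fejer_ge {s T₀ T C b : ℝ} (hC : 0 < C) (hT : 0 < T) (hTT : T ≤ T₀)
    (hν : ∀ u, 0 ≤ u → u ≤ T₀ → ‖charFun ν u‖ ≤ Real.exp (-(s ^ 2 * u ^ 2 / 4)))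
    (hν' : ∀ u, 0 ≤ u →
      ‖charFun ν u - Real.exp (-(s ^ 2 * u ^ 2 / 2))‖ ≤ C * s ^ 2 * u ^ 3)
    (hs : 6400 * C ≤ s) (ha : 8 ≤ s * T) (hb : 4 * |b| ≤ s * T) :
    1 / (10 * (s * T)) ≤ ∫ x, fejer (T * x + b) ∂ν := by
  have hs0 : 0 < s := by linarith
  set a := s * T with ha_def
  have ha0 : 0 < a := by linarith
  rw [integral_fejer_eq]
  set k : ℝ → ℝ := fun t =>
    (1 - t) * (Complex.exp (↑(t * b) * Complex.I) * charFun ν (t * T)).re with hk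
  have hkc : Continuous k := continuous_fejer_integrand T b
  have hii : ∀ p q, IntervalIntegrable k volume p q := fun p q => hkc.intervalIntegrable p q
  have h4a : 4 / a ≤ 1 / 2 := by rw [div_le_div_iff₀ ha0 two_pos]; linarith
  have h14 : 1 / a ≤ 4 / a := by gcongr; norm_num
  have hmain : ∀ t, 0 ≤ t → t ≤ 4 / a →
      (1 / 2) * Real.exp (-((a * t) ^ 2 / 2)) - 1 / 100
        ≤ (Complex.exp (↑(t * b) * Complex.I) * charFun ν (t * T)).re := by
    intro t ht ht4
    have hat : a * t ≤ 4 := by rw [le_div_iff₀ ha0] at ht4; linarith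
    have hsplit : Complex.exp (↑(t * b) * Complex.I) * charFun ν (t * T)
        = Complex.exp (↑(t * b) * Complex.I) * ((Real.exp (-((a * t) ^ 2 / 2)) : ℝ) : ℂ)
          + Complex.exp (↑(t * b) * Complex.I) *
            (charFun ν (t * T) - ((Real.exp (-((a * t) ^ 2 / 2)) : ℝ) : ℂ)) := by ring
    rw [hsplit, Complex.add_re, Complex.re_mul_ofReal, Complex.exp_ofReal_mul_I_re]
    have hcos : 1 / 2 ≤ Real.cos (t * b) := by
      have h1 : |t * b| ≤ 1 := by
        rw [abs_mul, abs_of_nonneg ht]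
        nlinarith [abs_nonneg b]
      have := Real.one_sub_sq_div_two_le_cos (x := t * b)
      have : (t * b) ^ 2 ≤ 1 := by rw [← sq_abs]; nlinarith [abs_nonneg (t * b)]
      linarith
    have herr := abs_re_exp_mul_le (t * b)
      (charFun ν (t * T) - ((Real.exp (-((a * t) ^ 2 / 2)) : ℝ) : ℂ))
    have h2 := hν' (t * T) (by positivity)
    have h3 : s ^ 2 * (t * T) ^ 2 = (a * t) ^ 2 := by rw [ha_def]; ring
    rw [h3] at h2
    -- The error is C(at)³/s ≤ 64C/s, whence the 6400 in `hs`.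
    have h4 : C * s ^ 2 * (t * T) ^ 3 ≤ 1 / 100 := by
      have : C * s ^ 2 * (t * T) ^ 3 = C * (a * t) ^ 3 / s := by
        rw [ha_def]; field_simp
      rw [this, div_le_iff₀ hs0]
      have : (a * t) ^ 3 ≤ 4 ^ 3 := by gcongr
      nlinarith
    have h5 := neg_abs_le (Complex.exp (↑(t * b) * Complex.I) *
      (charFun ν (t * T) - ((Real.exp (-((a * t) ^ 2 / 2)) : ℝ) : ℂ))).re
    have h6 := mul_le_mul_of_nonneg_right hcos (Real.exp_pos (-((a * t) ^ 2 / 2))).le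
    linarith
  have I1 : (1 / a - 0) * (29 / 200) ≤ ∫ t in (0 : ℝ)..(1 / a), k t := by
    rw [← smul_eq_mul, ← intervalIntegral.integral_const]
    refine intervalIntegral.integral_mono_on (by positivity) (by simp) (hii _ _) fun t ht => ?_
    have h1 := hmain t ht.1 (ht.2.trans h14)
    have hat : a * t ≤ 1 := by
      have := ht.2; rw [le_div_iff₀ ha0] at this; linarith
    have h2 : 0.6 ≤ Real.exp (-((a * t) ^ 2 / 2)) := by
      have e1 : -(1 / 2) ≤ -((a * t) ^ 2 / 2) := by
        have := mul_nonneg ha0.le ht.1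
        nlinarith
      refine le_trans ?_ (Real.exp_le_exp.2 e1)
      have e2 := Real.exp_one_lt_d9
      have e3 : Real.exp (-(1 / 2)) ^ 2 * Real.exp 1 = 1 := by
        rw [← Real.exp_nat_mul, ← Real.exp_add]; norm_num
      by_contra! h'
      have e4 := Real.exp_pos (-(1 / 2))
      have e5 : Real.exp (-(1 / 2)) ^ 2 < 0.36 := by nlinarith
      nlinarith [Real.exp_pos 1]
    have h3 : 29 / 100 ≤ (Complex.exp (↑(t * b) * Complex.I) * charFun ν (t * T)).re := by
      linarith
    have h4 : 1 / 2 ≤ 1 - t := by linarith [ht.2]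
    simp only [hk]
    nlinarith
  have I2 : (4 / a - 1 / a) * (-(1 / 100)) ≤ ∫ t in (1 / a)..(4 / a), k t := by
    rw [← smul_eq_mul, ← intervalIntegral.integral_const]
    refine intervalIntegral.integral_mono_on h14 (by simp) (hii _ _) fun t ht => ?_
    have ht0 : 0 ≤ t := le_trans (by positivity) ht.1
    have h1 := hmain t ht0 ht.2
    have h2 := Real.exp_pos (-((a * t) ^ 2 / 2))
    have h4 : 0 ≤ 1 - t := by linarith [ht.2]
    simp only [hk]
    nlinarith
  have I3 : -(Real.exp (-4) / a) ≤ ∫ t in (4 / a)..1, k t := by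
    have h1 : ∫ t in (4 / a)..1, -Real.exp (-(a * t)) ≤ ∫ t in (4 / a)..1, k t := by
      refine intervalIntegral.integral_mono_on (by linarith)
        (Continuous.intervalIntegrable (by fun_prop) _ _) (hii _ _) fun t ht => ?_
      have ht0 : 0 ≤ t := le_trans (by positivity) ht.1
      have hat : 4 ≤ a * t := by
        have := ht.1; rw [div_le_iff₀ ha0] at this; linarith
      have g1 := (neg_abs_le _).trans' (neg_le_neg (abs_re_exp_mul_le (t * b) (charFun ν (t * T))))
      have g2 := hν (t * T) (by positivity) (by nlinarith [ht.2])
      -- For at ≥ 4 one has (at)²/4 ≥ at, so an explicitly integrable exponential replaces the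
      -- Gaussian tail.
      have g3 : Real.exp (-(s ^ 2 * (t * T) ^ 2 / 4)) ≤ Real.exp (-(a * t)) := by
        have : s ^ 2 * (t * T) ^ 2 = (a * t) ^ 2 := by rw [ha_def]; ring
        rw [this, Real.exp_le_exp]
        nlinarith
      have g4 := ht.2
      simp only [hk]
      nlinarith [Real.exp_pos (-(a * t))]
    refine le_trans ?_ h1
    have hd : ∀ t ∈ Set.uIcc (4 / a) 1,
        HasDerivAt (fun t => Real.exp (-(a * t)) / a) (-Real.exp (-(a * t))) t := by
      intro t _
      have h0 : HasDerivAt (fun t : ℝ => -(a * t)) (-a) t := by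
        exact (((hasDerivAt_id t).const_mul a).neg).congr_deriv (by simp)
      refine (h0.exp.div_const a).congr_deriv ?_
      field_simp
    rw [intervalIntegral.integral_eq_sub_of_hasDerivAt hd
      (Continuous.intervalIntegrable (by fun_prop) _ _), mul_div_cancel₀ _ ha0.ne']
    have : 0 < Real.exp (-(a * 1)) / a := by positivity
    linarith
  have hexp : Real.exp (-4) ≤ 1 / 40 := by
    rw [Real.exp_neg, ← one_div]
    refine one_div_le_one_div_of_le (by norm_num) ?_
    have e2 := Real.exp_one_gt_d9
    have e3 : Real.exp 4 = Real.exp 1 ^ 4 := by rw [← Real.exp_nat_mul]; norm_num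
    rw [e3]
    calc (40 : ℝ) ≤ 2.7 ^ 4 := by norm_num
      _ ≤ _ := by gcongr; linarith
  rw [← intervalIntegral.integral_add_adjacent_intervals (hii 0 (1 / a)) (hii (1 / a) 1),
    ← intervalIntegral.integral_add_adjacent_intervals (hii (1 / a) (4 / a)) (hii (4 / a) 1)]
  have hfin : Real.exp (-4) / a ≤ 1 / 40 / a := by gcongr
  have e1 : (4 : ℝ) / a = 4 * (1 / a) := by ring
  have e2 : (1 : ℝ) / 40 / a = 1 / 40 * (1 / a) := by ring
  have e3 : 1 / (10 * a) = 1 / 10 * (1 / a) := by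
    rw [one_div_mul_one_div]
  rw [e3]
  rw [e1] at I2 I3 ⊢
  rw [e2] at hfin
  have : 0 < 1 / a := by positivity
  linarith

/-! ### Two-sided bounds for the expectation of g_α. -/

theorem gFun_le_exp {α m x : ℝ} (h0 : m ≤ α) (h1 : m ≤ 1 - α) :
    gFun α x ≤ Real.exp (-(m * |x|)) := by
  rw [gFun, Real.exp_le_exp]
  rcases le_total 0 x with hx | hx
  · rw [abs_of_nonneg hx]
    exact (min_le_right _ _).trans (by nlinarith)
  · rw [abs_of_nonpos hx]
    exact (min_le_left _ _).trans (by nlinarith)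

theorem continuous_gFun (α : ℝ) : Continuous (gFun α) := by
  unfold gFun
  fun_prop

theorem gFun_nonneg (α x : ℝ) : 0 ≤ gFun α x := (Real.exp_pos _).le

theorem integrable_gFun {α : ℝ} (hα : α ∈ Set.Ioo (0 : ℝ) 1) : Integrable (gFun α) ν := by
  refine Integrable.of_bound (C := 1) (continuous_gFun α).aestronglyMeasurable
    (ae_of_all _ fun x => ?_)
  rw [Real.norm_of_nonneg (gFun_nonneg _ _)]
  simpa using gFun_le_exp (x := x) hα.1.le (by linarith [hα.2] : (0 : ℝ) ≤ 1 - α)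

theorem integral_gFun_le {s T₀ α : ℝ} (hs : 0 < s) (hT₀ : 0 < T₀) (hT₁ : T₀ ≤ 1)
    (hα : α ∈ Set.Ioo (0 : ℝ) 1)
    (hν : ∀ u, 0 ≤ u → u ≤ T₀ → ‖charFun ν u‖ ≤ Real.exp (-(s ^ 2 * u ^ 2 / 4))) :
    ∫ x, gFun α x ∂ν ≤ 32 / T₀ / (s * (1 - α) * α) := by
  obtain ⟨h0, h1⟩ := hα
  have h1' : 0 < 1 - α := by linarith
  set m := (1 - α) * α with hm
  have hm0 : 0 < m := by positivity
  -- T ≤ min(α, 1 - α) makes e^{-T|x|} dominate g_α, and T ≤ T₀ keeps the frequencies in the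
  -- controlled range.
  set T := T₀ * m with hTdef
  have hT : 0 < T := by positivity
  have hm1 : m ≤ 1 := by nlinarith
  have hTT : T ≤ T₀ := by nlinarith
  have hTm : T ≤ m := by nlinarith
  have hpt : ∀ x, gFun α x ≤ 4 * (fejer (T * x + 0) + fejer (T * x + Real.pi)) := by
    intro x
    refine (gFun_le_exp (m := T) (hTm.trans (by nlinarith)) (hTm.trans (by nlinarith))).trans ?_
    have := exp_neg_abs_le_fejer (T * x)
    rwa [abs_mul, abs_of_pos hT, ← add_zero (T * x), add_assoc, zero_add] at this
  have hle := integral_mono (integrable_gFun (ν := ν) ⟨h0, h1⟩)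
    (((integrable_fejer T 0).add (integrable_fejer T Real.pi)).const_mul 4) hpt
  simp only [Pi.add_apply] at hle
  rw [integral_const_mul, integral_add (integrable_fejer T 0) (integrable_fejer T Real.pi)] at hle
  have e1 := integral_fejer_le hs hT hTT hν 0
  have e2 := integral_fejer_le hs hT hTT hν Real.pi
  have e3 : 32 / T₀ / (s * (1 - α) * α) = 8 * (4 / (s * T)) := by
    rw [hTdef, hm]; field_simp; norm_num
  rw [e3]
  linarith

/-- The minorant with M = 2880, rescaled to the interval. In units of H/s, the narrow kernel gives
1/(10M) = 288/M² and the two translates cost 2 · 4 · 18/M² = 144/M². -/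
theorem le_measureReal_interval {s T₀ C H c : ℝ} (hC : 0 < C)
    (hν : ∀ u, 0 ≤ u → u ≤ T₀ → ‖charFun ν u‖ ≤ Real.exp (-(s ^ 2 * u ^ 2 / 4)))
    (hν' : ∀ u, 0 ≤ u →
      ‖charFun ν u - Real.exp (-(s ^ 2 * u ^ 2 / 2))‖ ≤ C * s ^ 2 * u ^ 3)
    (hs : 6400 * C ≤ s) (hH : 0 < H) (hHT : 2880 ≤ H * T₀) (hHs : 4 * H ≤ s) (hc : |c| = H) :
    72 / 2880 ^ 2 * (H / s) ≤ ν.real {x | |x - c| ≤ H} := by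
  have hs0 : 0 < s := by linarith
  have hT : 0 < 1 / H := by positivity
  have hT2 : 2880 * (1 / H) ≤ T₀ := by
    rw [mul_one_div, div_le_iff₀ hH]; linarith
  have hT1 : 1 / H ≤ T₀ := by linarith
  have hpt : ∀ x, fejer (2880 * (1 / H) * x + -(2880 * c / H))
      - 18 / 2880 ^ 2 * (fejer (1 / H * x + -(c / H)) + fejer (1 / H * x + (-(c / H) + Real.pi)))
      ≤ Set.indicator {x | |x - c| ≤ H} 1 x := by
    intro x
    have h := fejer_sub_le_indicator (M := 2880) (by norm_num) ((x - c) / H)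
    have e1 : 2880 * ((x - c) / H) = 2880 * (1 / H) * x + -(2880 * c / H) := by field_simp; ring
    have e2 : (x - c) / H = 1 / H * x + -(c / H) := by field_simp; ring
    have e3 : (|(x - c) / H| ≤ 1) = (|x - c| ≤ H) := by
      rw [abs_div, abs_of_pos hH, div_le_one hH]
    have e4 : Set.indicator {y : ℝ | |y| ≤ 1} (1 : ℝ → ℝ) ((x - c) / H)
        = Set.indicator {x | |x - c| ≤ H} 1 x := by
      simp only [Set.indicator, Set.mem_ofPred_eq, e3, Pi.one_apply]
    rw [e4, e1, e2, add_assoc] at h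
    exact h
  have hms : MeasurableSet {x : ℝ | |x - c| ≤ H} := by
    apply measurableSet_le <;> fun_prop
  have i1 := integrable_fejer (ν := ν) (2880 * (1 / H)) (-(2880 * c / H))
  have i2 := integrable_fejer (ν := ν) (1 / H) (-(c / H))
  have i3 := integrable_fejer (ν := ν) (1 / H) (-(c / H) + Real.pi)
  have i4 : Integrable (fun x => 18 / 2880 ^ 2 * (fejer (1 / H * x + -(c / H))
      + fejer (1 / H * x + (-(c / H) + Real.pi)))) ν := (i2.add i3).const_mul _
  have hle := integral_mono (i1.sub i4) ((integrable_const (1 : ℝ)).indicator hms) hpt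
  have hind : ∫ x, Set.indicator {x | |x - c| ≤ H} (1 : ℝ → ℝ) x ∂ν = ν.real {x | |x - c| ≤ H} :=
    integral_indicator_one hms
  simp only [Pi.sub_apply] at hle
  erw [hind] at hle
  rw [integral_sub i1 i4, integral_const_mul, integral_add i2 i3] at hle
  have hsH : 2 ≤ s * (1 / H) := by rw [mul_one_div, le_div_iff₀ hH]; linarith
  have l1 := integral_fejer_ge (T := 2880 * (1 / H)) (b := -(2880 * c / H)) hC (by positivity)
    hT2 hν hν' hs (by linarith) (by
      rw [abs_neg, abs_div, abs_mul, hc, abs_of_pos hH, mul_div_assoc, div_self hH.ne']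
      norm_num
      rw [← div_eq_mul_inv, mul_div_assoc', le_div_iff₀ hH]
      linarith)
  have l2 := integral_fejer_le hs0 hT hT1 hν (-(c / H))
  have l3 := integral_fejer_le hs0 hT hT1 hν (-(c / H) + Real.pi)
  have e1 : 1 / (10 * (s * (2880 * (1 / H)))) = 1 / 28800 * (H / s) := by field_simp; norm_num
  have e2 : 4 / (s * (1 / H)) = 4 * (H / s) := by field_simp
  rw [e1] at l1
  rw [e2] at l2 l3
  have : 0 < H / s := by positivity
  linarith

theorem le_integral_gFun {s T₀ C α : ℝ} (hC : 0 < C) (hT₀ : 0 < T₀) (hα : α ∈ Set.Ioo (0 : ℝ) 1)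
    (hν : ∀ u, 0 ≤ u → u ≤ T₀ → ‖charFun ν u‖ ≤ Real.exp (-(s ^ 2 * u ^ 2 / 4)))
    (hν' : ∀ u, 0 ≤ u →
      ‖charFun ν u - Real.exp (-(s ^ 2 * u ^ 2 / 2))‖ ≤ C * s ^ 2 * u ^ 3)
    (hs : 6400 * C ≤ s * (1 - α) * α) (hs' : 4 * (2880 / T₀) ≤ s * (1 - α) * α) :
    Real.exp (-(4 * (2880 / T₀))) * (72 / 2880 ^ 2 * (2880 / T₀)) / (s * (1 - α) * α)
      ≤ ∫ x, gFun α x ∂ν := by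
  have hα' := hα
  obtain ⟨h0, h1⟩ := hα
  have h1' : 0 < 1 - α := by linarith
  set K := 2880 / T₀ with hK
  have hK0 : 0 < K := by positivity
  set m := (1 - α) * α with hm
  have hm0 : 0 < m := by positivity
  have hm1 : m ≤ 1 := by nlinarith
  rw [mul_assoc, ← hm] at hs hs' ⊢
  have hs0 : 0 < s := by
    by_contra! h
    nlinarith
  have hsm : s * m ≤ s := by nlinarith
  set H := K / m with hHdef
  have hH : 0 < H := by positivity
  have hHT : 2880 ≤ H * T₀ := by
    have : H * T₀ = 2880 / m := by rw [hHdef, hK]; field_simp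
    rw [this, le_div_iff₀ hm0]; linarith
  have hHs : 4 * H ≤ s := by
    rw [hHdef, mul_div_assoc', div_le_iff₀ hm0]; linarith
  -- The interval is taken on the side of 0 where g_α decays more slowly: [-2H, 0] if α ≤ 1/2,
  -- otherwise [0, 2H]. There log g_α has slope ±min(α, 1 - α), and min(α, 1 - α) H ≤ 2K.
  obtain ⟨c, hc, hg⟩ : ∃ c, |c| = H ∧ ∀ x, |x - c| ≤ H → Real.exp (-(4 * K)) ≤ gFun α x := by
    have hHm : H * m = K := by rw [hHdef]; field_simp
    rcases le_total α (1 / 2) with hle | hle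
    · have hαH : α * H ≤ 2 * K := by rw [← hHm, hm]; nlinarith [mul_pos h0 hH]
      refine ⟨-H, by rw [abs_neg, abs_of_pos hH], fun x hx => ?_⟩
      rw [abs_le] at hx
      rw [gFun, Real.exp_le_exp]
      refine le_min ?_ ?_ <;> nlinarith
    · have hαH : (1 - α) * H ≤ 2 * K := by rw [← hHm, hm]; nlinarith [mul_pos h1' hH]
      refine ⟨H, abs_of_pos hH, fun x hx => ?_⟩
      rw [abs_le] at hx
      rw [gFun, Real.exp_le_exp]
      refine le_min ?_ ?_ <;> nlinarith
  have hmeas := le_measureReal_interval hC hν hν' (by linarith) hH hHT hHs hc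
  have hms : MeasurableSet {x : ℝ | |x - c| ≤ H} := by
    apply measurableSet_le <;> fun_prop
  have hind : ∫ x, Set.indicator {x | |x - c| ≤ H} (fun _ => Real.exp (-(4 * K))) x ∂ν
      = ν.real {x | |x - c| ≤ H} * Real.exp (-(4 * K)) := by
    rw [integral_indicator_const _ hms, smul_eq_mul]
  have hle := integral_mono ((integrable_const (Real.exp (-(4 * K)))).indicator hms)
    (integrable_gFun (ν := ν) hα') (fun x => by
      by_cases hx : |x - c| ≤ H
      · rw [Set.indicator_of_mem (by exact hx)]; exact hg x hx
      · rw [Set.indicator_of_notMem (by exact hx)]; exact gFun_nonneg _ _)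
  rw [hind] at hle
  refine le_trans ?_ hle
  have e1 : Real.exp (-(4 * K)) * (72 / 2880 ^ 2 * K) / (s * m)
      = 72 / 2880 ^ 2 * (H / s) * Real.exp (-(4 * K)) := by
    rw [hHdef]; field_simp
  rw [e1]
  exact mul_le_mul_of_nonneg_right hmeas (Real.exp_pos _).le

end CharFun

/-! ### Taylor estimates for the characteristic function of one centred variable. -/

theorem norm_exp_mul_I_sub_le (x : ℝ) :
    ‖Complex.exp (x * Complex.I) - (1 + x * Complex.I - x ^ 2 / 2)‖ ≤ 4 * |x| ^ 3 := by
  have hn : ‖(x : ℂ) * Complex.I‖ = |x| := by simp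
  rcases le_total |x| 1 with h | h
  · have hb := Complex.exp_bound (x := x * Complex.I) (by rwa [hn]) (n := 3) (by norm_num)
    have e : ∑ m ∈ Finset.range 3, ((x : ℂ) * Complex.I) ^ m / m.factorial
        = 1 + x * Complex.I - x ^ 2 / 2 := by
      simp [Finset.sum_range_succ, mul_pow]
      ring
    rw [e, hn] at hb
    refine hb.trans ?_
    norm_num [Nat.factorial]
    nlinarith [pow_nonneg (abs_nonneg x) 3]
  · refine (norm_sub_le _ _).trans ?_
    rw [Complex.norm_exp_ofReal_mul_I]
    have h1 : ‖(1 : ℂ) + x * Complex.I - x ^ 2 / 2‖ ≤ 1 + |x| + |x| ^ 2 / 2 := by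
      refine (norm_sub_le _ _).trans ?_
      have := norm_add_le (1 : ℂ) (x * Complex.I)
      rw [hn] at this
      simp at this ⊢
      linarith
    have h2 : |x| ≤ |x| ^ 2 := by nlinarith
    have h3 : |x| ^ 2 ≤ |x| ^ 3 := by nlinarith [sq_nonneg |x|]
    linarith

section SingleVariable

variable {X : Type*} [MeasurableSpace X] {Q : Measure X} [IsProbabilityMeasure Q] {ζ : X → ℝ}

theorem integrable_sq_of_cube (hζ : Measurable ζ) (h3 : Integrable (fun x => |ζ x| ^ 3) Q) :
    Integrable (fun x => ζ x ^ 2) Q := by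
  refine Integrable.mono' ((integrable_const (1 : ℝ)).add h3) (by fun_prop)
    (ae_of_all _ fun x => ?_)
  rw [norm_pow, Real.norm_eq_abs, Pi.add_apply]
  rcases le_total |ζ x| 1 with h | h
  · nlinarith [abs_nonneg (ζ x), pow_nonneg (abs_nonneg (ζ x)) 3]
  · nlinarith [sq_nonneg |ζ x|]

theorem integrable_of_cube (hζ : Measurable ζ) (h3 : Integrable (fun x => |ζ x| ^ 3) Q) :
    Integrable ζ Q := by
  refine Integrable.mono' ((integrable_const (1 : ℝ)).add (integrable_sq_of_cube hζ h3))
    hζ.aestronglyMeasurable (ae_of_all _ fun x => ?_)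
  rw [Real.norm_eq_abs, Pi.add_apply, ← sq_abs]
  nlinarith [sq_nonneg (|ζ x| - 1), abs_nonneg (ζ x)]

/-- Truncation at level l. The choices l = 1 and l = half the second moment let third moments absorb
every second-moment error. -/
theorem second_moment_le (hζ : Measurable ζ) (h3 : Integrable (fun x => |ζ x| ^ 3) Q) {l : ℝ}
    (hl : 0 < l) : ∫ x, ζ x ^ 2 ∂Q ≤ l ^ 2 + (∫ x, |ζ x| ^ 3 ∂Q) / l := by
  have h : ∀ x, ζ x ^ 2 ≤ l ^ 2 + |ζ x| ^ 3 / l := by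
    intro x
    rw [← sq_abs]
    rcases le_total |ζ x| l with h | h
    · have : |ζ x| ^ 2 ≤ l ^ 2 := by gcongr
      have : 0 ≤ |ζ x| ^ 3 / l := by positivity
      linarith
    · have : |ζ x| ^ 2 ≤ |ζ x| ^ 3 / l := by
        rw [le_div_iff₀ hl]
        nlinarith [sq_nonneg |ζ x|]
      nlinarith [sq_nonneg l]
  have := integral_mono (integrable_sq_of_cube hζ h3)
    ((integrable_const (l ^ 2)).add (h3.div_const l)) h
  simp only [Pi.add_apply] at this
  rw [integral_add (integrable_const _) (h3.div_const l), integral_div] at this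
  simpa using this

theorem norm_integral_exp_sub_le (hζ : Measurable ζ) (h3 : Integrable (fun x => |ζ x| ^ 3) Q)
    (h0 : ∫ x, ζ x ∂Q = 0) :
    ‖∫ x, Complex.exp (ζ x * Complex.I) ∂Q - ((1 - (∫ x, ζ x ^ 2 ∂Q) / 2 : ℝ) : ℂ)‖
      ≤ 4 * ∫ x, |ζ x| ^ 3 ∂Q := by
  have i1 := (integrable_of_cube hζ h3).ofReal (𝕜 := ℂ)
  have i2 := (integrable_sq_of_cube hζ h3).ofReal (𝕜 := ℂ)
  have ie : Integrable (fun x => Complex.exp (ζ x * Complex.I)) Q :=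
    Integrable.of_bound (C := 1) (by fun_prop)
      (ae_of_all _ fun x => (Complex.norm_exp_ofReal_mul_I _).le)
  have ip : Integrable (fun x => (1 : ℂ) + ζ x * Complex.I - ζ x ^ 2 / 2) Q := by
    refine ((integrable_const (1 : ℂ)).add (i1.mul_const Complex.I)).sub ?_
    simpa using i2.div_const 2
  have e : ∫ x, ((1 : ℂ) + ζ x * Complex.I - ζ x ^ 2 / 2) ∂Q
      = ((1 - (∫ x, ζ x ^ 2 ∂Q) / 2 : ℝ) : ℂ) := by
    have i2' : Integrable (fun x => (ζ x : ℂ) ^ 2 / 2) Q := by simpa using i2.div_const 2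
    have i1' : Integrable (fun x => (ζ x : ℂ) * Complex.I) Q := i1.mul_const Complex.I
    have i01 : Integrable (fun x => (1 : ℂ) + ζ x * Complex.I) Q := (integrable_const 1).add i1'
    rw [integral_sub i01 i2', integral_add (integrable_const _) i1', integral_mul_const,
      integral_complex_ofReal, h0, integral_div]
    have : ∫ x, (ζ x : ℂ) ^ 2 ∂Q = ((∫ x, ζ x ^ 2 ∂Q : ℝ) : ℂ) := by
      rw [← integral_complex_ofReal]; simp
    rw [this]
    simp
  rw [← e, ← integral_sub ie ip, ← integral_const_mul]
  exact norm_integral_le_of_norm_le (h3.const_mul 4)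
    (ae_of_all _ fun x => norm_exp_mul_I_sub_le (ζ x))

/-- The exponential form multiplies well over coordinates. With w and β the second and third
absolute moments, w ≤ 2 is the case 1 + y ≤ e^y; for w ≥ 2 the inequality w ≤ 1 + β makes the
exponent nonnegative, so the bound is trivial. -/
theorem norm_integral_exp_le (hζ : Measurable ζ) (h3 : Integrable (fun x => |ζ x| ^ 3) Q)
    (h0 : ∫ x, ζ x ∂Q = 0) :
    ‖∫ x, Complex.exp (ζ x * Complex.I) ∂Q‖
      ≤ Real.exp (-((∫ x, ζ x ^ 2 ∂Q) / 2) + 4 * ∫ x, |ζ x| ^ 3 ∂Q) := by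
  have hb : 0 ≤ ∫ x, |ζ x| ^ 3 ∂Q := integral_nonneg fun x => by positivity
  have hsub := norm_integral_exp_sub_le hζ h3 h0
  have h1 := second_moment_le hζ h3 one_pos
  rcases le_total (∫ x, ζ x ^ 2 ∂Q) 2 with h | h
  · have hn : ‖((1 - (∫ x, ζ x ^ 2 ∂Q) / 2 : ℝ) : ℂ)‖ = 1 - (∫ x, ζ x ^ 2 ∂Q) / 2 := by
      rw [Complex.norm_real, Real.norm_of_nonneg (by linarith)]
    have := norm_sub_norm_le (∫ x, Complex.exp (ζ x * Complex.I) ∂Q)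
      ((1 - (∫ x, ζ x ^ 2 ∂Q) / 2 : ℝ) : ℂ)
    have := Real.add_one_le_exp (-((∫ x, ζ x ^ 2 ∂Q) / 2) + 4 * ∫ x, |ζ x| ^ 3 ∂Q)
    linarith
  · have h2 : ‖∫ x, Complex.exp (ζ x * Complex.I) ∂Q‖ ≤ 1 := by
      have := norm_integral_le_of_norm_le_const (μ := Q) (C := 1)
        (f := fun x => Complex.exp (ζ x * Complex.I))
        (ae_of_all _ fun x => (Complex.norm_exp_ofReal_mul_I _).le)
      simpa using this
    refine h2.trans (Real.one_le_exp ?_)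
    linarith

theorem norm_integral_exp_sub_gaussian_le (hζ : Measurable ζ)
    (h3 : Integrable (fun x => |ζ x| ^ 3) Q) (h0 : ∫ x, ζ x ∂Q = 0) :
    ‖∫ x, Complex.exp (ζ x * Complex.I) ∂Q - (Real.exp (-((∫ x, ζ x ^ 2 ∂Q) / 2)) : ℝ)‖
      ≤ 5 * ∫ x, |ζ x| ^ 3 ∂Q := by
  have hsub := norm_integral_exp_sub_le hζ h3 h0
  set w := ∫ x, ζ x ^ 2 ∂Q with hw
  set β := ∫ x, |ζ x| ^ 3 ∂Q with hβ
  have hb : 0 ≤ β := integral_nonneg fun x => by positivity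
  have hw0 : 0 ≤ w := integral_nonneg fun x => sq_nonneg _
  have h1 := second_moment_le hζ h3 one_pos
  rw [← hw, ← hβ] at h1
  -- For w ≤ 2 the difference is at most w²/4, and truncation at w/2 gives w² ≤ 4β. For w > 2 it is
  -- at most w/2 ≤ w - 1 ≤ β.
  have hexp : |1 - w / 2 - Real.exp (-(w / 2))| ≤ β := by
    have l1 := Real.add_one_le_exp (-(w / 2))
    rw [abs_of_nonpos (by linarith)]
    rcases le_or_gt w 2 with h | h
    · rcases hw0.eq_or_lt with h' | h'
      · simp [← h', hb]
      have h2 := second_moment_le hζ h3 (half_pos h')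
      rw [← hw, ← hβ] at h2
      have h3 : w ^ 2 ≤ 4 * β := by
        have : β / (w / 2) = 2 * β / w := by field_simp
        rw [this, ← sub_le_iff_le_add', le_div_iff₀ h'] at h2
        nlinarith [sq_nonneg w]
      have h4 : Real.exp (-(w / 2)) ≤ 1 - w / 2 + (w / 2) ^ 2 := by
        have := Real.abs_exp_sub_one_sub_id_le (x := -(w / 2)) (by
          rw [abs_neg, abs_of_nonneg (by linarith)]; linarith)
        have := (abs_le.1 this).2
        nlinarith
      nlinarith
    · have : Real.exp (-(w / 2)) ≤ 1 := Real.exp_le_one_iff.2 (by linarith)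
      linarith
  calc _ ≤ ‖∫ x, Complex.exp (ζ x * Complex.I) ∂Q - ((1 - w / 2 : ℝ) : ℂ)‖
        + ‖((1 - w / 2 : ℝ) : ℂ) - (Real.exp (-(w / 2)) : ℝ)‖ := norm_sub_le_norm_sub_add_norm_sub _ _ _
    _ ≤ 4 * β + β := by
      refine add_le_add hsub ?_
      rw [← Complex.ofReal_sub, Complex.norm_real]
      exact hexp
    _ = _ := by ring

end SingleVariable

/-! ### Characteristic functions of sums of independent variables. -/

theorem norm_prod_sub_prod_le {ι : Type*} (s : Finset ι) (a b : ι → ℂ) (ha : ∀ i, ‖a i‖ ≤ 1)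
    (hb : ∀ i, ‖b i‖ ≤ 1) : ‖∏ i ∈ s, a i - ∏ i ∈ s, b i‖ ≤ ∑ i ∈ s, ‖a i - b i‖ := by
  classical
  induction s using Finset.induction_on with
  | empty => simp
  | insert i s hi ih =>
    rw [Finset.prod_insert hi, Finset.prod_insert hi, Finset.sum_insert hi]
    have e : a i * ∏ j ∈ s, a j - b i * ∏ j ∈ s, b j
        = (a i - b i) * ∏ j ∈ s, a j + b i * (∏ j ∈ s, a j - ∏ j ∈ s, b j) := by ring
    rw [e]
    refine (norm_add_le _ _).trans (add_le_add ?_ ?_)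
    · rw [norm_mul]
      have : ‖∏ j ∈ s, a j‖ ≤ 1 := by
        rw [norm_prod]; exact Finset.prod_le_one (fun _ _ => norm_nonneg _) fun j _ => ha j
      nlinarith [norm_nonneg (a i - b i)]
    · rw [norm_mul]
      nlinarith [norm_nonneg (∏ j ∈ s, a j - ∏ j ∈ s, b j), hb i]

section Sum

variable {ι : Type*} [Fintype ι] {Ω : ι → Type*} [∀ j, MeasurableSpace (Ω j)]
  {Q : (j : ι) → Measure (Ω j)} [∀ j, IsProbabilityMeasure (Q j)] {ζ : (j : ι) → Ω j → ℝ}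

theorem charFun_map_sum_pi (hζ : ∀ j, Measurable (ζ j)) (u : ℝ) :
    charFun ((Measure.pi Q).map fun x => ∑ j, ζ j (x j)) u
      = ∏ j, ∫ x, Complex.exp ((u * ζ j x : ℝ) * Complex.I) ∂(Q j) := by
  have hm : Measurable fun x : (j : ι) → Ω j => ∑ j, ζ j (x j) :=
    Finset.measurable_sum _ fun j _ => (hζ j).comp (measurable_pi_apply j)
  rw [charFun_apply_real, integral_map hm.aemeasurable (by fun_prop),
    ← integral_fintype_prod_eq_prod (𝕜 := ℂ)
      (fun j x => Complex.exp ((u * ζ j x : ℝ) * Complex.I))]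
  refine integral_congr_ae (ae_of_all _ fun x => ?_)
  simp only
  rw [← Complex.exp_sum]
  congr 1
  push_cast
  rw [Finset.mul_sum, Finset.sum_mul]

theorem norm_charFun_map_sum_le (hζ : ∀ j, Measurable (ζ j))
    (h3 : ∀ j, Integrable (fun x => |ζ j x| ^ 3) (Q j)) (h0 : ∀ j, ∫ x, ζ j x ∂(Q j) = 0)
    {s C : ℝ} (hs : s ^ 2 = ∑ j, ∫ x, ζ j x ^ 2 ∂(Q j)) (hC : 0 < C)
    (hρ : ∑ j, ∫ x, |ζ j x| ^ 3 ∂(Q j) ≤ C * s ^ 2) (u : ℝ) (hu : 0 ≤ u)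
    (huC : u ≤ 1 / (16 * C)) :
    ‖charFun ((Measure.pi Q).map fun x => ∑ j, ζ j (x j)) u‖
      ≤ Real.exp (-(s ^ 2 * u ^ 2 / 4)) := by
  rw [charFun_map_sum_pi hζ, norm_prod]
  have hj : ∀ j, ‖∫ x, Complex.exp ((u * ζ j x : ℝ) * Complex.I) ∂(Q j)‖
      ≤ Real.exp (-(u ^ 2 * (∫ x, ζ j x ^ 2 ∂(Q j)) / 2) + 4 * (u ^ 3 * ∫ x, |ζ j x| ^ 3 ∂(Q j))) := by
    intro j
    have e3 : ∀ x, |u * ζ j x| ^ 3 = u ^ 3 * |ζ j x| ^ 3 := fun x => by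
      rw [abs_mul, mul_pow, abs_of_nonneg hu]
    have := norm_integral_exp_le (Q := Q j) (ζ := fun x => u * ζ j x) ((hζ j).const_mul u)
      (by simp_rw [e3]; exact (h3 j).const_mul _) (by rw [integral_const_mul, h0, mul_zero])
    simp_rw [e3, mul_pow, integral_const_mul] at this
    exact this
  refine (Finset.prod_le_prod (fun _ _ => norm_nonneg _) fun j _ => hj j).trans ?_
  rw [← Real.exp_sum, Real.exp_le_exp, Finset.sum_add_distrib, Finset.sum_neg_distrib,
    ← Finset.sum_div, ← Finset.mul_sum, ← Finset.mul_sum, ← Finset.mul_sum, ← hs]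
  -- The cubic term 4C s²u³ then uses up at most half of s²u²/2.
  have h16 : 16 * C * u ≤ 1 := by
    rw [le_div_iff₀ (by positivity)] at huC; linarith
  have h1 : u ^ 3 * ∑ j, ∫ x, |ζ j x| ^ 3 ∂(Q j) ≤ u ^ 3 * (C * s ^ 2) := by gcongr
  have h2 : 0 ≤ s ^ 2 * u ^ 2 := by positivity
  nlinarith

theorem norm_charFun_map_sum_sub_le (hζ : ∀ j, Measurable (ζ j))
    (h3 : ∀ j, Integrable (fun x => |ζ j x| ^ 3) (Q j)) (h0 : ∀ j, ∫ x, ζ j x ∂(Q j) = 0)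
    {s C : ℝ} (hs : s ^ 2 = ∑ j, ∫ x, ζ j x ^ 2 ∂(Q j))
    (hρ : ∑ j, ∫ x, |ζ j x| ^ 3 ∂(Q j) ≤ C * s ^ 2) (u : ℝ) (hu : 0 ≤ u) :
    ‖charFun ((Measure.pi Q).map fun x => ∑ j, ζ j (x j)) u
        - (Real.exp (-(s ^ 2 * u ^ 2 / 2)) : ℝ)‖ ≤ 5 * C * s ^ 2 * u ^ 3 := by
  have hj : ∀ j, ‖∫ x, Complex.exp ((u * ζ j x : ℝ) * Complex.I) ∂(Q j)
      - (Real.exp (-(u ^ 2 * (∫ x, ζ j x ^ 2 ∂(Q j)) / 2)) : ℝ)‖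
      ≤ 5 * (u ^ 3 * ∫ x, |ζ j x| ^ 3 ∂(Q j)) := by
    intro j
    have e3 : ∀ x, |u * ζ j x| ^ 3 = u ^ 3 * |ζ j x| ^ 3 := fun x => by
      rw [abs_mul, mul_pow, abs_of_nonneg hu]
    have := norm_integral_exp_sub_gaussian_le (Q := Q j) (ζ := fun x => u * ζ j x)
      ((hζ j).const_mul u)
      (by simp_rw [e3]; exact (h3 j).const_mul _) (by rw [integral_const_mul, h0, mul_zero])
    simp_rw [e3, mul_pow, integral_const_mul] at this
    exact this
  have e : (Real.exp (-(s ^ 2 * u ^ 2 / 2)) : ℂ)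
      = ∏ j, ((Real.exp (-(u ^ 2 * (∫ x, ζ j x ^ 2 ∂(Q j)) / 2)) : ℝ) : ℂ) := by
    rw [← Complex.ofReal_prod, ← Real.exp_sum, Finset.sum_neg_distrib, ← Finset.sum_div,
      ← Finset.mul_sum, ← hs, mul_comm]
  rw [charFun_map_sum_pi hζ, e]
  refine (norm_prod_sub_prod_le _ _ _ (fun j => ?_) fun j => ?_).trans ?_
  · have := norm_integral_le_of_norm_le_const (μ := Q j) (C := 1)
      (f := fun x => Complex.exp ((u * ζ j x : ℝ) * Complex.I))
      (ae_of_all _ fun x => (Complex.norm_exp_ofReal_mul_I _).le)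
    simpa using this
  · rw [Complex.norm_real, Real.norm_of_nonneg (Real.exp_pos _).le, Real.exp_le_one_iff,
      Left.neg_nonpos_iff]
    have : 0 ≤ ∫ x, ζ j x ^ 2 ∂(Q j) := integral_nonneg fun x => sq_nonneg _
    positivity
  · refine (Finset.sum_le_sum fun j _ => hj j).trans ?_
    rw [← Finset.mul_sum, ← Finset.mul_sum]
    have h1 : u ^ 3 * ∑ j, ∫ x, |ζ j x| ^ 3 ∂(Q j) ≤ u ^ 3 * (C * s ^ 2) := by gcongr
    linarith

end Sum

/-! ### Laws given by densities, and the Bayes error. -/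

section Law

variable {X : Type*} [MeasurableSpace X] {μ : Measure X} {f g p : X → ℝ}

theorem IsDensity.integrable (hf : IsDensity μ f) : Integrable f μ := by
  refine ⟨hf.measurable.aestronglyMeasurable, ?_⟩
  rw [hasFiniteIntegral_iff_ofReal (ae_of_all _ hf.nonneg), hf.lintegral_eq_one]
  exact ENNReal.one_lt_top

theorem IsDensity.integral_eq_one (hf : IsDensity μ f) : ∫ x, f x ∂μ = 1 := by
  rw [integral_eq_lintegral_of_nonneg_ae (ae_of_all _ hf.nonneg)
    hf.measurable.aestronglyMeasurable, hf.lintegral_eq_one, ENNReal.toReal_one]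

theorem IsDensity.of_integral_eq_one (hm : Measurable f) (h0 : ∀ x, 0 ≤ f x)
    (hi : Integrable f μ) (h1 : ∫ x, f x ∂μ = 1) : IsDensity μ f :=
  ⟨hm, h0, by rw [← ofReal_integral_eq_lintegral_ofReal hi (ae_of_all _ h0), h1,
    ENNReal.ofReal_one]⟩

theorem IsDensity.isProbabilityMeasure (hf : IsDensity μ f) : IsProbabilityMeasure (law μ f) :=
  ⟨by rw [law, withDensity_apply _ MeasurableSet.univ, setLIntegral_univ, hf.lintegral_eq_one]⟩

theorem integrable_law_iff (hp : Measurable p) (h0 : ∀ x, 0 ≤ p x) {h : X → ℝ} :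
    Integrable h (law μ p) ↔ Integrable (fun x => p x * h x) μ := by
  rw [law, integrable_withDensity_iff_integrable_smul' hp.ennreal_ofReal
    (ae_of_all _ fun x => ENNReal.ofReal_lt_top)]
  simp [ENNReal.toReal_ofReal (h0 _)]

theorem integral_law (hp : Measurable p) (h0 : ∀ x, 0 ≤ p x) (h : X → ℝ) :
    ∫ x, h x ∂(law μ p) = ∫ x, p x * h x ∂μ := by
  rw [law, integral_withDensity_eq_integral_toReal_smul hp.ennreal_ofReal
    (ae_of_all _ fun x => ENNReal.ofReal_lt_top)]
  simp [ENNReal.toReal_ofReal (h0 _)]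

theorem ae_law_iff (hp : Measurable p) (h0 : ∀ x, 0 ≤ p x) {P : X → Prop} :
    (∀ᵐ x ∂(law μ p), P x) ↔ ∀ᵐ x ∂μ, p x ≠ 0 → P x := by
  rw [law, ae_withDensity_iff hp.ennreal_ofReal]
  refine Filter.eventually_congr (ae_of_all _ fun x => ?_)
  simp [lt_iff_le_and_ne, h0 x, eq_comm]

theorem IsDensity.ae_ne_zero (hf : IsDensity μ f) : ∀ᵐ x ∂(law μ f), f x ≠ 0 := by
  rw [ae_law_iff hf.measurable hf.nonneg]
  exact ae_of_all _ fun x h => h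

/-- Mutually absolutely continuous laws have densities with the same zeros. -/
theorem ae_eq_zero_iff (hf : IsDensity μ f) (hg : IsDensity μ g) (h1 : law μ f ≪ law μ g)
    (h2 : law μ g ≪ law μ f) : ∀ᵐ x ∂μ, f x = 0 ↔ g x = 0 := by
  have a : ∀ᵐ x ∂(law μ f), g x ≠ 0 := h1.ae_le hg.ae_ne_zero
  have b : ∀ᵐ x ∂(law μ g), f x ≠ 0 := h2.ae_le hf.ae_ne_zero
  rw [ae_law_iff hf.measurable hf.nonneg] at a
  rw [ae_law_iff hg.measurable hg.nonneg] at b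
  filter_upwards [a, b] with x hx hy
  tauto

/-- Where the estimator errs under z, φ_z is the smaller density; the two error events partition the
space. -/
theorem affinity_eq_two_mul_errorProb {φ : Fin 2 → X → ℝ} (hφ : ∀ z, IsDensity μ (φ z))
    {zhat : X → Fin 2} (hz : IsBayesEstimator φ zhat) :
    affinity μ (φ 0) (φ 1) = 2 * errorProb μ φ zhat := by
  obtain ⟨hzm, hzo⟩ := hz
  have hms : ∀ z, MeasurableSet {x | zhat x ≠ z} := fun z =>
    (hzm (measurableSet_singleton z)).compl
  have hlaw : ∀ z, (law μ (φ z)).real {x | zhat x ≠ z} = ∫ x in {x | zhat x ≠ z}, φ z x ∂μ := by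
    intro z
    rw [Measure.real, law, withDensity_apply _ (hms z),
      integral_eq_lintegral_of_nonneg_ae (ae_of_all _ (hφ z).nonneg)
        (hφ z).measurable.aestronglyMeasurable]
  have hcompl : {x | zhat x ≠ 1} = {x | zhat x ≠ 0}ᶜ := by
    ext x
    simp only [Set.mem_ofPred_eq, Set.mem_compl_iff]
    have : ∀ w : Fin 2, w ≠ 1 ↔ ¬ w ≠ 0 := by decide
    exact this _
  have hmin : Integrable (fun x => min (φ 0 x) (φ 1 x)) μ :=
    (hφ 0).integrable.inf (hφ 1).integrable
  have e0 : ∫ x in {x | zhat x ≠ 0}, φ 0 x ∂μ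
      = ∫ x in {x | zhat x ≠ 0}, min (φ 0 x) (φ 1 x) ∂μ := by
    refine setIntegral_congr_fun (hms 0) fun x hx => ?_
    have h1 : zhat x = 1 := by
      have : ∀ w : Fin 2, w ≠ 0 → w = 1 := by decide
      exact this _ hx
    exact (min_eq_left (h1 ▸ hzo x 0)).symm
  have e1 : ∫ x in {x | zhat x ≠ 1}, φ 1 x ∂μ
      = ∫ x in {x | zhat x ≠ 1}, min (φ 0 x) (φ 1 x) ∂μ := by
    refine setIntegral_congr_fun (hms 1) fun x hx => ?_
    have h1 : zhat x = 0 := by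
      have : ∀ w : Fin 2, w ≠ 1 → w = 0 := by decide
      exact this _ hx
    exact (min_eq_right (h1 ▸ hzo x 1)).symm
  rw [affinity, errorProb, Fin.sum_univ_two, hlaw, hlaw, e0, e1, hcompl,
    integral_add_compl (hms 0) hmin]
  ring

end Law

/-! ### The Chernoff integral of two equivalent densities. -/

/-- Two probability densities with the same zeros. -/
structure IsEquivPair {X : Type*} [MeasurableSpace X] (μ : Measure X) (f g : X → ℝ) : Prop where
  left : IsDensity μ f
  right : IsDensity μ g
  ae_zero_iff : ∀ᵐ x ∂μ, f x = 0 ↔ g x = 0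

namespace IsEquivPair

variable {X : Type*} [MeasurableSpace X] {μ : Measure X} {f g : X → ℝ}

theorem measurable_logLR (h : IsEquivPair μ f g) : Measurable (logLR f g) :=
  Real.measurable_log.comp (h.left.measurable.div h.right.measurable)

theorem measurable_rpow (h : IsEquivPair μ f g) (α : ℝ) :
    Measurable fun x => f x ^ (1 - α) * g x ^ α :=
  (h.left.measurable.pow_const _).mul (h.right.measurable.pow_const _)

theorem rpow_nonneg (h : IsEquivPair μ f g) (α : ℝ) (x : X) : 0 ≤ f x ^ (1 - α) * g x ^ α :=
  mul_nonneg (Real.rpow_nonneg (h.left.nonneg x) _) (Real.rpow_nonneg (h.right.nonneg x) _)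

/-- Makes the Chernoff integral a moment generating function. On the common zeros both sides vanish;
α = 0 is separate because 0 ^ 0 = 1, but then the factor f vanishes. -/
theorem rpow_ae_eq (h : IsEquivPair μ f g) (α : ℝ) :
    ∀ᵐ x ∂μ, f x ^ (1 - α) * g x ^ α = f x * Real.exp (α * -logLR f g x) := by
  filter_upwards [h.ae_zero_iff] with x hx
  by_cases hf : f x = 0
  · have hg := hx.1 hf
    rw [hf, hg, zero_mul]
    by_cases hα : α = 0
    · simp [hα]
    · rw [Real.zero_rpow hα, mul_zero]
  · have hg : g x ≠ 0 := fun e => hf (hx.2 e)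
    have hf' : 0 < f x := lt_of_le_of_ne (h.left.nonneg x) (Ne.symm hf)
    have hg' : 0 < g x := lt_of_le_of_ne (h.right.nonneg x) (Ne.symm hg)
    rw [logLR, Real.log_div hf hg, Real.rpow_def_of_pos hf', Real.rpow_def_of_pos hg',
      ← Real.exp_add]
    nth_rw 2 [← Real.exp_log hf']
    rw [← Real.exp_add]
    ring_nf

theorem integral_rpow_eq_mgf (h : IsEquivPair μ f g) (α : ℝ) :
    ∫ x, f x ^ (1 - α) * g x ^ α ∂μ
      = ProbabilityTheory.mgf (fun x => -logLR f g x) (law μ f) α := by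
  rw [ProbabilityTheory.mgf, integral_law h.left.measurable h.left.nonneg]
  exact integral_congr_ae (h.rpow_ae_eq α)

theorem mem_integrableExpSet_iff (h : IsEquivPair μ f g) (α : ℝ) :
    α ∈ ProbabilityTheory.integrableExpSet (fun x => -logLR f g x) (law μ f)
      ↔ Integrable (fun x => f x ^ (1 - α) * g x ^ α) μ := by
  rw [ProbabilityTheory.integrableExpSet, Set.mem_ofPred_eq,
    integrable_law_iff h.left.measurable h.left.nonneg]
  exact integrable_congr ((h.rpow_ae_eq α).mono fun x hx => hx.symm)

theorem Icc_subset_integrableExpSet (h : IsEquivPair μ f g) :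
    Set.Icc 0 1 ⊆ ProbabilityTheory.integrableExpSet (fun x => -logLR f g x) (law μ f) := by
  rw [← segment_eq_Icc zero_le_one]
  refine ProbabilityTheory.convex_integrableExpSet.segment_subset ?_ ?_
  · rw [h.mem_integrableExpSet_iff]; simpa using h.left.integrable
  · rw [h.mem_integrableExpSet_iff]; simpa using h.right.integrable

theorem Ioo_subset_interior (h : IsEquivPair μ f g) :
    Set.Ioo 0 1 ⊆ interior
      (ProbabilityTheory.integrableExpSet (fun x => -logLR f g x) (law μ f)) :=
  interior_maximal (Set.Ioo_subset_Icc_self.trans h.Icc_subset_integrableExpSet) isOpen_Ioo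

theorem integrable_rpow (h : IsEquivPair μ f g) {α : ℝ} (hα : α ∈ Set.Icc (0 : ℝ) 1) :
    Integrable (fun x => f x ^ (1 - α) * g x ^ α) μ :=
  (h.mem_integrableExpSet_iff α).1 (h.Icc_subset_integrableExpSet hα)

theorem integral_rpow_pos (h : IsEquivPair μ f g) {α : ℝ} (hα : α ∈ Set.Icc (0 : ℝ) 1) :
    0 < ∫ x, f x ^ (1 - α) * g x ^ α ∂μ := by
  have := h.left.isProbabilityMeasure
  rw [h.integral_rpow_eq_mgf]
  exact ProbabilityTheory.mgf_pos (h.Icc_subset_integrableExpSet hα)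

theorem exp_chernoffDiv (h : IsEquivPair μ f g) {α : ℝ} (hα : α ∈ Set.Icc (0 : ℝ) 1) :
    Real.exp (chernoffDiv μ f g α) = (∫ x, f x ^ (1 - α) * g x ^ α ∂μ)⁻¹ := by
  rw [chernoffDiv, Real.exp_neg, Real.exp_log (h.integral_rpow_pos hα)]

/-- Strict convexity of exp: equality forces the log-likelihood ratio to vanish almost everywhere,
that is, f = g. -/
theorem strictConvexOn_integral_rpow (h : IsEquivPair μ f g) (hne : ¬ f =ᵐ[μ] g) :
    StrictConvexOn ℝ (Set.Icc 0 1) fun α : ℝ => ∫ x, f x ^ (1 - α) * g x ^ α ∂μ := by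
  refine ⟨convex_Icc 0 1, fun a ha b hb hab p q hp hq hpq => ?_⟩
  have := h.left.isProbabilityMeasure
  simp only [h.integral_rpow_eq_mgf, ProbabilityTheory.mgf, smul_eq_mul]
  have ia : Integrable (fun x => Real.exp (a * -logLR f g x)) (law μ f) :=
    h.Icc_subset_integrableExpSet ha
  have ib : Integrable (fun x => Real.exp (b * -logLR f g x)) (law μ f) :=
    h.Icc_subset_integrableExpSet hb
  have ic : Integrable (fun x => Real.exp ((p * a + q * b) * -logLR f g x)) (law μ f) :=
    h.Icc_subset_integrableExpSet (convex_Icc 0 1 ha hb hp.le hq.le hpq)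
  have hle : ∀ x, Real.exp ((p * a + q * b) * -logLR f g x)
      ≤ p * Real.exp (a * -logLR f g x) + q * Real.exp (b * -logLR f g x) := by
    intro x
    have := convexOn_exp.2 (Set.mem_univ (a * -logLR f g x)) (Set.mem_univ (b * -logLR f g x))
      hp.le hq.le hpq
    simp only [smul_eq_mul] at this
    have e : p * (a * -logLR f g x) + q * (b * -logLR f g x)
        = (p * a + q * b) * -logLR f g x := by ring
    rwa [e] at this
  have iab : Integrable (fun x => p * Real.exp (a * -logLR f g x)
      + q * Real.exp (b * -logLR f g x)) (law μ f) := (ia.const_mul p).add (ib.const_mul q)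
  have hsum : p * ∫ x, Real.exp (a * -logLR f g x) ∂(law μ f)
      + q * ∫ x, Real.exp (b * -logLR f g x) ∂(law μ f)
      = ∫ x, (p * Real.exp (a * -logLR f g x) + q * Real.exp (b * -logLR f g x)) ∂(law μ f) := by
    rw [integral_add (ia.const_mul p) (ib.const_mul q), integral_const_mul, integral_const_mul]
  rw [hsum]
  refine lt_of_le_of_ne (integral_mono ic iab hle) fun heq => hne ?_
  have hz : ∫ x, (p * Real.exp (a * -logLR f g x) + q * Real.exp (b * -logLR f g x)
      - Real.exp ((p * a + q * b) * -logLR f g x)) ∂(law μ f) = 0 := by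
    rw [integral_sub iab ic, heq, sub_self]
  rw [integral_eq_zero_iff_of_nonneg (fun x => sub_nonneg.2 (hle x)) (iab.sub ic)] at hz
  have hz' := (ae_law_iff h.left.measurable h.left.nonneg).1 hz
  filter_upwards [hz', h.ae_zero_iff] with x hx hx0
  by_cases hf : f x = 0
  · rw [hf, hx0.1 hf]
  have hg : g x ≠ 0 := fun e => hf (hx0.2 e)
  have hx1 := hx hf
  simp only [Pi.zero_apply] at hx1
  have hlog : logLR f g x = 0 := by
    by_contra hl
    have hne' : a * -logLR f g x ≠ b * -logLR f g x := fun e =>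
      hab (mul_right_cancel₀ (neg_ne_zero.2 hl) e)
    have := strictConvexOn_exp.2 (Set.mem_univ _) (Set.mem_univ _) hne' hp hq hpq
    simp only [smul_eq_mul] at this
    have e : p * (a * -logLR f g x) + q * (b * -logLR f g x)
        = (p * a + q * b) * -logLR f g x := by ring
    rw [e] at this
    linarith
  have hpos : 0 < f x / g x := div_pos (lt_of_le_of_ne (h.left.nonneg x) (Ne.symm hf))
    (lt_of_le_of_ne (h.right.nonneg x) (Ne.symm hg))
  have : f x / g x = 1 := Real.eq_one_of_pos_of_log_eq_zero hpos hlog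
  rwa [div_eq_one_iff_eq hg] at this

theorem continuousOn_integral_rpow (h : IsEquivPair μ f g) :
    ContinuousOn (fun α : ℝ => ∫ x, f x ^ (1 - α) * g x ^ α ∂μ) (Set.Icc 0 1) := by
  have := h.left.isProbabilityMeasure
  have hm := h.measurable_logLR
  simp only [h.integral_rpow_eq_mgf, ProbabilityTheory.mgf]
  have i1 : Integrable (fun x => Real.exp (1 * -logLR f g x)) (law μ f) :=
    h.Icc_subset_integrableExpSet (Set.right_mem_Icc.2 zero_le_one)
  refine continuousOn_of_dominated (bound := fun x => 1 + Real.exp (1 * -logLR f g x))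
    (fun α _ => by fun_prop) (fun α hα => ae_of_all _ fun x => ?_)
    ((integrable_const 1).add i1) (ae_of_all _ fun x => by fun_prop)
  rw [Real.norm_of_nonneg (Real.exp_pos _).le, one_mul]
  have he := Real.exp_pos (-logLR f g x)
  rcases le_total 0 (-logLR f g x) with hx | hx
  · have : Real.exp (α * -logLR f g x) ≤ Real.exp (-logLR f g x) :=
      Real.exp_le_exp.2 (by nlinarith [hα.2])
    linarith
  · have : Real.exp (α * -logLR f g x) ≤ 1 :=
      Real.exp_le_one_iff.2 (mul_nonpos_of_nonneg_of_nonpos hα.1 hx)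
    linarith

theorem isChernoffArgmax_iff (h : IsEquivPair μ f g) (α : ℝ) :
    IsChernoffArgmax μ f g α ↔ α ∈ Set.Ioo (0 : ℝ) 1 ∧
      IsMinOn (fun α : ℝ => ∫ x, f x ^ (1 - α) * g x ^ α ∂μ) (Set.Ioo 0 1) α := by
  refine and_congr_right fun hα => ?_
  rw [isMaxOn_iff, isMinOn_iff]
  refine forall₂_congr fun β hβ => ?_
  rw [chernoffDiv, chernoffDiv, neg_le_neg_iff, Real.log_le_log_iff
    (h.integral_rpow_pos (Set.Ioo_subset_Icc_self hα))
    (h.integral_rpow_pos (Set.Ioo_subset_Icc_self hβ))]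

theorem existsUnique_isChernoffArgmax (h : IsEquivPair μ f g) (hne : ¬ f =ᵐ[μ] g) :
    ∃! α, IsChernoffArgmax μ f g α := by
  simp only [h.isChernoffArgmax_iff]
  have hsc := h.strictConvexOn_integral_rpow hne
  obtain ⟨α, hα, hmin⟩ := isCompact_Icc.exists_isMinOn ⟨0, by simp⟩ h.continuousOn_integral_rpow
  set M : ℝ → ℝ := fun α => ∫ x, f x ^ (1 - α) * g x ^ α ∂μ with hM
  have h0 : M 0 = 1 := by simpa [hM] using h.left.integral_eq_one
  have h1 : M 1 = 1 := by simpa [hM] using h.right.integral_eq_one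
  -- This keeps the minimum over [0, 1] away from the endpoints, where M = 1.
  have hhalf : M (1 / 2) < 1 := by
    have := hsc.2 (Set.left_mem_Icc.2 zero_le_one) (Set.right_mem_Icc.2 zero_le_one)
      zero_ne_one (one_half_pos (α := ℝ)) (one_half_pos (α := ℝ)) (by norm_num)
    rw [h0, h1] at this
    norm_num at this ⊢
    exact this
  have hαm : M α < 1 := (isMinOn_iff.1 hmin (1 / 2) (by norm_num)).trans_lt hhalf
  have hα' : α ∈ Set.Ioo (0 : ℝ) 1 := by
    refine ⟨lt_of_le_of_ne hα.1 ?_, lt_of_le_of_ne hα.2 ?_⟩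
    · rintro rfl; linarith
    · rintro rfl; linarith
  refine ⟨α, ⟨hα', hmin.on_subset Set.Ioo_subset_Icc_self⟩, fun β hβ => ?_⟩
  exact (hsc.subset Set.Ioo_subset_Icc_self (convex_Ioo 0 1)).eq_of_isMinOn hβ.2
    (hmin.on_subset Set.Ioo_subset_Icc_self) hβ.1 hα'

theorem chernoffInfo_eq {α : ℝ} (hα : IsChernoffArgmax μ f g α) :
    chernoffInfo μ f g = chernoffDiv μ f g α := by
  refine IsGreatest.csSup_eq ⟨⟨α, hα.1, rfl⟩, ?_⟩
  rintro _ ⟨β, hβ, rfl⟩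
  exact isMaxOn_iff.1 hα.2 β hβ

/-! ### The tilted law. -/

section Tilted

variable {α : ℝ}

theorem measurable_tilted (h : IsEquivPair μ f g) (α : ℝ) : Measurable (tilted μ f g α) :=
  (h.measurable_rpow α).mul_const _

theorem tilted_nonneg (h : IsEquivPair μ f g) (α : ℝ) (x : X) : 0 ≤ tilted μ f g α x :=
  mul_nonneg (h.rpow_nonneg α x) (Real.exp_pos _).le

theorem isDensity_tilted (h : IsEquivPair μ f g) (hα : α ∈ Set.Icc (0 : ℝ) 1) :
    IsDensity μ (tilted μ f g α) := by
  refine IsDensity.of_integral_eq_one (h.measurable_tilted α) (h.tilted_nonneg α)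
    ((h.integrable_rpow hα).mul_const _) ?_
  simp only [tilted]
  rw [integral_mul_const, h.exp_chernoffDiv hα, mul_inv_cancel₀ (h.integral_rpow_pos hα).ne']

theorem tilted_ae_ne_zero (h : IsEquivPair μ f g) (α : ℝ) :
    ∀ᵐ x ∂μ, f x ≠ 0 → tilted μ f g α x ≠ 0 := by
  filter_upwards [h.rpow_ae_eq α] with x hx hf
  rw [tilted, hx]
  exact mul_ne_zero (mul_ne_zero hf (Real.exp_pos _).ne') (Real.exp_pos _).ne'

theorem ae_tilted_pos (h : IsEquivPair μ f g) (α : ℝ) :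
    ∀ᵐ x ∂(law μ (tilted μ f g α)), 0 < f x ∧ 0 < g x := by
  rw [ae_law_iff (h.measurable_tilted α) (h.tilted_nonneg α)]
  filter_upwards [h.rpow_ae_eq α, h.ae_zero_iff] with x hx h0 ht
  have hf : f x ≠ 0 := fun e => ht (by rw [tilted, hx, e, zero_mul, zero_mul])
  have hg : g x ≠ 0 := fun e => hf (h0.2 e)
  exact ⟨lt_of_le_of_ne (h.left.nonneg x) (Ne.symm hf),
    lt_of_le_of_ne (h.right.nonneg x) (Ne.symm hg)⟩

theorem integrable_tilted_iff (h : IsEquivPair μ f g) (α : ℝ) {φ : X → ℝ} :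
    Integrable φ (law μ (tilted μ f g α))
      ↔ Integrable (fun x => φ x * Real.exp (α * -logLR f g x)) (law μ f) := by
  rw [integrable_law_iff (h.measurable_tilted α) (h.tilted_nonneg α),
    integrable_law_iff h.left.measurable h.left.nonneg,
    ← integrable_mul_const_iff (IsUnit.mk0 _ (Real.exp_pos (chernoffDiv μ f g α)).ne')
      (fun x => f x * (φ x * Real.exp (α * -logLR f g x)))]
  refine integrable_congr ?_
  filter_upwards [h.rpow_ae_eq α] with x hx
  rw [tilted, hx]
  ring

theorem integral_tilted_eq (h : IsEquivPair μ f g) (α : ℝ) (φ : X → ℝ) :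
    ∫ x, φ x ∂(law μ (tilted μ f g α))
      = (∫ x, φ x * Real.exp (α * -logLR f g x) ∂(law μ f))
        * Real.exp (chernoffDiv μ f g α) := by
  rw [integral_law (h.measurable_tilted α) (h.tilted_nonneg α),
    integral_law h.left.measurable h.left.nonneg, ← integral_mul_const]
  refine integral_congr_ae ?_
  filter_upwards [h.rpow_ae_eq α] with x hx
  rw [tilted, hx]
  ring

/-- An α in (0, 1) is interior to the domain of the moment generating function, so the tilted law
has all moments of the log-likelihood ratio. -/
theorem integrable_abs_logLR_pow (h : IsEquivPair μ f g) (hα : α ∈ Set.Ioo (0 : ℝ) 1) (k : ℕ) :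
    Integrable (fun x => |logLR f g x| ^ k) (law μ (tilted μ f g α)) := by
  rw [h.integrable_tilted_iff]
  simpa using ProbabilityTheory.integrable_pow_abs_mul_exp_of_mem_interior_integrableExpSet
    (h.Ioo_subset_interior hα) k

theorem integrable_logLR (h : IsEquivPair μ f g) (hα : α ∈ Set.Ioo (0 : ℝ) 1) :
    Integrable (logLR f g) (law μ (tilted μ f g α)) := by
  rw [← integrable_norm_iff h.measurable_logLR.aestronglyMeasurable]
  simpa using h.integrable_abs_logLR_pow hα 1

theorem integrable_abs_centredLLR_cube (h : IsEquivPair μ f g) (hα : α ∈ Set.Ioo (0 : ℝ) 1) :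
    Integrable (fun x => |centredLLR μ f g α x| ^ 3) (law μ (tilted μ f g α)) := by
  have := (h.isDensity_tilted (Set.Ioo_subset_Icc_self hα)).isProbabilityMeasure
  have hm := h.measurable_logLR
  unfold centredLLR
  set m := ∫ y, logLR f g y ∂(law μ (tilted μ f g α))
  refine Integrable.mono' (((h.integrable_abs_logLR_pow hα 3).add
    (integrable_const (|m| ^ 3))).const_mul 4) (by fun_prop) (ae_of_all _ fun x => ?_)
  rw [norm_pow, Real.norm_eq_abs, abs_abs, Pi.add_apply]
  have h1 : |logLR f g x - m| ≤ |logLR f g x| + |m| := abs_sub _ _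
  have h2 : |logLR f g x - m| ^ 3 ≤ (|logLR f g x| + |m|) ^ 3 := by gcongr
  refine h2.trans ?_
  have ha := abs_nonneg (logLR f g x)
  have hb := abs_nonneg m
  nlinarith [mul_nonneg (add_nonneg ha hb) (sq_nonneg (|logLR f g x| - |m|))]

theorem integral_centredLLR (h : IsEquivPair μ f g) (hα : α ∈ Set.Ioo (0 : ℝ) 1) :
    ∫ x, centredLLR μ f g α x ∂(law μ (tilted μ f g α)) = 0 := by
  have := (h.isDensity_tilted (Set.Ioo_subset_Icc_self hα)).isProbabilityMeasure
  unfold centredLLR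
  rw [integral_sub (h.integrable_logLR hα) (integrable_const _)]
  simp

/-- At the maximiser of the Chernoff divergence the log-likelihood ratio is centred. -/
theorem integral_logLR_eq_zero (h : IsEquivPair μ f g) (hα : IsChernoffArgmax μ f g α) :
    ∫ x, logLR f g x ∂(law μ (tilted μ f g α)) = 0 := by
  obtain ⟨hα', hmin⟩ := (h.isChernoffArgmax_iff α).1 hα
  simp only [h.integral_rpow_eq_mgf] at hmin
  have hd := (hmin.isLocalMin (Ioo_mem_nhds hα'.1 hα'.2)).hasDerivAt_eq_zero
    (ProbabilityTheory.hasDerivAt_mgf (h.Ioo_subset_interior hα'))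
  rw [h.integral_tilted_eq]
  simp only [neg_mul, integral_neg, neg_eq_zero] at hd
  simp only [hd, zero_mul]

/-- Change of measure: min(f, g) = f^{1-α} g^α min(l^α, l^{α-1}), where l = f/g. -/
theorem affinity_eq (h : IsEquivPair μ f g) (α : ℝ) :
    affinity μ f g = (∫ x, gFun α (logLR f g x) ∂(law μ (tilted μ f g α)))
      * Real.exp (-chernoffDiv μ f g α) := by
  rw [affinity, integral_law (h.measurable_tilted α) (h.tilted_nonneg α), ← integral_mul_const]
  refine integral_congr_ae ?_
  filter_upwards [h.rpow_ae_eq α, h.ae_zero_iff] with x hx h0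
  rw [tilted, hx, Real.exp_neg]
  have hE := (Real.exp_pos (chernoffDiv μ f g α)).ne'
  have e : f x * Real.exp (α * -logLR f g x) * Real.exp (chernoffDiv μ f g α)
      * gFun α (logLR f g x) * (Real.exp (chernoffDiv μ f g α))⁻¹
      = f x * Real.exp (α * -logLR f g x) * gFun α (logLR f g x) := by field_simp
  rw [e, gFun, Monotone.map_min Real.exp_monotone]
  by_cases hf : f x = 0
  · rw [hf, h0.1 hf]; simp
  have hg : g x ≠ 0 := fun e => hf (h0.2 e)
  have hf' : 0 < f x := lt_of_le_of_ne (h.left.nonneg x) (Ne.symm hf)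
  have hg' : 0 < g x := lt_of_le_of_ne (h.right.nonneg x) (Ne.symm hg)
  rw [mul_min_of_nonneg _ _ (by positivity)]
  congr 1
  · rw [mul_assoc, ← Real.exp_add]; ring_nf; simp
  · rw [mul_assoc, ← Real.exp_add]
    have : α * -logLR f g x + (α - 1) * logLR f g x = -logLR f g x := by ring
    rw [this, logLR, Real.exp_neg, Real.exp_log (div_pos hf' hg')]
    field_simp

end Tilted

end IsEquivPair

/-! ### Product densities and product measures. -/

section Pi

variable {n : ℕ} {Ω : Fin n → Type*} [∀ j, MeasurableSpace (Ω j)]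
  {μ : (j : Fin n) → Measure (Ω j)} [∀ j, SigmaFinite (μ j)]

theorem isDensity_pi {f : (j : Fin n) → Ω j → ℝ} (hf : ∀ j, IsDensity (μ j) (f j)) :
    IsDensity (Measure.pi μ) fun x => ∏ j, f j (x j) := by
  refine IsDensity.of_integral_eq_one ?_ (fun x => Finset.prod_nonneg fun j _ => (hf j).nonneg _)
    (Integrable.fintype_prod_dep fun j => (hf j).integrable) ?_
  · exact Finset.measurable_prod _ fun j _ => (hf j).measurable.comp (measurable_pi_apply j)
  · rw [integral_fintype_prod_eq_prod (𝕜 := ℝ) f]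
    exact Finset.prod_eq_one fun j _ => (hf j).integral_eq_one

/-- The law with a product density is the product of the laws. -/
theorem law_pi {f : (j : Fin n) → Ω j → ℝ} (hf : ∀ j, IsDensity (μ j) (f j)) :
    law (Measure.pi μ) (fun x => ∏ j, f j (x j)) = Measure.pi fun j => law (μ j) (f j) := by
  have hp : ∀ j, IsProbabilityMeasure (law (μ j) (f j)) := fun j => (hf j).isProbabilityMeasure
  refine (Measure.pi_eq fun s hs => ?_).symm
  have hs' : MeasurableSet (Set.pi Set.univ s) := MeasurableSet.univ_pi hs
  have hi : ∀ j, Integrable ((s j).indicator (f j)) (μ j) := fun j =>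
    (hf j).integrable.indicator (hs j)
  have h0 : ∀ j x, 0 ≤ (s j).indicator (f j) x := fun j x =>
    Set.indicator_nonneg (fun x _ => (hf j).nonneg x) x
  have hj : ∀ j, law (μ j) (f j) (s j) = ENNReal.ofReal (∫ x, (s j).indicator (f j) x ∂(μ j)) := by
    intro j
    rw [law, withDensity_apply _ (hs j), integral_indicator (hs j),
      ofReal_integral_eq_lintegral_ofReal (hf j).integrable.integrableOn
        (ae_of_all _ (hf j).nonneg)]
  simp_rw [hj]
  rw [← ENNReal.ofReal_prod_of_nonneg fun j _ => integral_nonneg (h0 j),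
    ← integral_fintype_prod_eq_prod (𝕜 := ℝ), law, withDensity_apply _ hs',
    ofReal_integral_eq_lintegral_ofReal (Integrable.fintype_prod_dep hi)
      (ae_of_all _ fun x => Finset.prod_nonneg fun j _ => h0 j _),
    ← lintegral_indicator hs']
  refine lintegral_congr fun x => ?_
  by_cases hx : x ∈ Set.pi Set.univ s
  · rw [Set.indicator_of_mem hx]
    congr 1
    exact Finset.prod_congr rfl fun j _ => (Set.indicator_of_mem (hx j (Set.mem_univ j)) _).symm
  · rw [Set.indicator_of_notMem hx]
    simp only [Set.mem_pi, Set.mem_univ, forall_const, not_forall] at hx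
    obtain ⟨j, hj⟩ := hx
    rw [Finset.prod_eq_zero (Finset.mem_univ j) (Set.indicator_of_notMem hj _),
      ENNReal.ofReal_zero]

end Pi

/-! ### Tilting of product families. -/

namespace InFamily

variable {n : ℕ} {Ω : Fin n → Type*} [∀ j, MeasurableSpace (Ω j)]
  {μ : (j : Fin n) → Measure (Ω j)} {φ : Fin 2 → (j : Fin n) → Ω j → ℝ} {α : ℝ}

theorem absolutelyContinuous (h : InFamily μ φ) {z w : Fin 2} (hzw : z ≠ w) :
    law (Measure.pi μ) (prodDensity φ z) ≪ law (Measure.pi μ) (prodDensity φ w) :=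
  (InformationTheory.klDiv_ne_top_iff.1 (h.kl_lt_top z w hzw).ne).1

theorem rpow_prodDensity (h : InFamily μ φ) (α : ℝ) (x : (j : Fin n) → Ω j) :
    prodDensity φ 0 x ^ (1 - α) * prodDensity φ 1 x ^ α
      = ∏ j, φ 0 j (x j) ^ (1 - α) * φ 1 j (x j) ^ α := by
  rw [prodDensity, prodDensity, Finset.prod_mul_distrib,
    Real.finsetProd_rpow _ _ fun j _ => (h.isDensity 0 j).nonneg _,
    Real.finsetProd_rpow _ _ fun j _ => (h.isDensity 1 j).nonneg _]

variable [∀ j, SigmaFinite (μ j)]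

theorem isDensity_prodDensity (h : InFamily μ φ) (z : Fin 2) :
    IsDensity (Measure.pi μ) (prodDensity φ z) :=
  isDensity_pi (h.isDensity z)

theorem law_prodDensity (h : InFamily μ φ) (z : Fin 2) :
    law (Measure.pi μ) (prodDensity φ z) = Measure.pi fun j => law (μ j) (φ z j) :=
  law_pi (h.isDensity z)

/-- Absolute continuity passes to marginals. -/
theorem absolutelyContinuous_coord (h : InFamily μ φ) {z w : Fin 2} (hzw : z ≠ w) (j : Fin n) :
    law (μ j) (φ z j) ≪ law (μ j) (φ w j) := by
  have hp : ∀ z j, IsProbabilityMeasure (law (μ j) (φ z j)) := fun z j =>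
    (h.isDensity z j).isProbabilityMeasure
  have := (h.absolutelyContinuous hzw).map (measurable_pi_apply j)
  rw [h.law_prodDensity, h.law_prodDensity] at this
  have e : ∀ z, (Measure.pi fun j => law (μ j) (φ z j)).map (fun x => x j) = law (μ j) (φ z j) :=
    fun z => (measurePreserving_eval (fun j => law (μ j) (φ z j)) j).map_eq
  rwa [e, e] at this

theorem isEquivPair (h : InFamily μ φ) :
    IsEquivPair (Measure.pi μ) (prodDensity φ 0) (prodDensity φ 1) :=
  ⟨h.isDensity_prodDensity 0, h.isDensity_prodDensity 1,
    ae_eq_zero_iff (h.isDensity_prodDensity 0) (h.isDensity_prodDensity 1)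
      (h.absolutelyContinuous (by decide)) (h.absolutelyContinuous (by decide))⟩

theorem isEquivPair_coord (h : InFamily μ φ) (j : Fin n) :
    IsEquivPair (μ j) (φ 0 j) (φ 1 j) :=
  ⟨h.isDensity 0 j, h.isDensity 1 j,
    ae_eq_zero_iff (h.isDensity 0 j) (h.isDensity 1 j)
      (h.absolutelyContinuous_coord (by decide) j) (h.absolutelyContinuous_coord (by decide) j)⟩

theorem not_ae_eq (h : InFamily μ φ) : ¬ prodDensity φ 0 =ᵐ[Measure.pi μ] prodDensity φ 1 := by
  intro he
  have hk := h.kl_pos 0 1 (by decide)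
  have := (h.isDensity_prodDensity 1).isProbabilityMeasure
  have e : law (Measure.pi μ) (prodDensity φ 0) = law (Measure.pi μ) (prodDensity φ 1) :=
    withDensity_congr_ae (he.mono fun x hx => by simp only [hx])
  rw [e, InformationTheory.klDiv_self] at hk
  exact lt_irrefl _ hk

/-- The normalising integral factorises by Fubini, so the coordinates stay independent under the
tilted law. -/
theorem tilted_prodDensity (h : InFamily μ φ) (hα : α ∈ Set.Icc (0 : ℝ) 1) :
    tilted (Measure.pi μ) (prodDensity φ 0) (prodDensity φ 1) α
      = fun x => ∏ j, tilted (μ j) (φ 0 j) (φ 1 j) α (x j) := by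
  funext x
  simp only [tilted]
  rw [h.isEquivPair.exp_chernoffDiv hα, Finset.prod_mul_distrib, h.rpow_prodDensity]
  simp_rw [h.rpow_prodDensity]
  rw [integral_fintype_prod_eq_prod (𝕜 := ℝ)
    (fun j x => φ 0 j x ^ (1 - α) * φ 1 j x ^ α), ← Finset.prod_inv_distrib]
  congr 1
  exact Finset.prod_congr rfl fun j _ => ((h.isEquivPair_coord j).exp_chernoffDiv hα).symm

theorem law_tilted (h : InFamily μ φ) (hα : α ∈ Set.Icc (0 : ℝ) 1) :
    law (Measure.pi μ) (tilted (Measure.pi μ) (prodDensity φ 0) (prodDensity φ 1) α)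
      = Measure.pi (coordLaw μ φ α) := by
  rw [h.tilted_prodDensity hα, law_pi fun j => (h.isEquivPair_coord j).isDensity_tilted hα]
  rfl

theorem isProbabilityMeasure_coordLaw (h : InFamily μ φ) (hα : α ∈ Set.Icc (0 : ℝ) 1)
    (j : Fin n) : IsProbabilityMeasure (coordLaw μ φ α j) :=
  ((h.isEquivPair_coord j).isDensity_tilted hα).isProbabilityMeasure

theorem measurable_coordZ (h : InFamily μ φ) (α : ℝ) (j : Fin n) : Measurable (coordZ μ φ α j) :=
  (h.isEquivPair_coord j).measurable_logLR.sub_const _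

theorem logLR_prodDensity (h : InFamily μ φ) (hα : α ∈ Set.Icc (0 : ℝ) 1) :
    ∀ᵐ x ∂(Measure.pi (coordLaw μ φ α)), logLR (prodDensity φ 0) (prodDensity φ 1) x
      = ∑ j, logLR (φ 0 j) (φ 1 j) (x j) := by
  rw [← h.law_tilted hα]
  filter_upwards [h.isEquivPair.ae_tilted_pos α] with x hx
  have h0 : ∀ j, φ 0 j (x j) ≠ 0 := fun j =>
    Finset.prod_ne_zero_iff.1 hx.1.ne' j (Finset.mem_univ j)
  have h1 : ∀ j, φ 1 j (x j) ≠ 0 := fun j =>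
    Finset.prod_ne_zero_iff.1 hx.2.ne' j (Finset.mem_univ j)
  simp only [logLR, prodDensity]
  rw [← Finset.prod_div_distrib, Real.log_prod fun j _ => div_ne_zero (h0 j) (h1 j)]

/-- The coordinate means need not vanish, but at the maximiser their sum does, so centring each
coordinate leaves the sum unchanged. -/
theorem logLR_ae_eq_sum_coordZ (h : InFamily μ φ)
    (hα : IsChernoffArgmax (Measure.pi μ) (prodDensity φ 0) (prodDensity φ 1) α) :
    ∀ᵐ x ∂(Measure.pi (coordLaw μ φ α)), logLR (prodDensity φ 0) (prodDensity φ 1) x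
      = ∑ j, coordZ μ φ α j (x j) := by
  have hα' := Set.Ioo_subset_Icc_self hα.1
  have hp := h.isProbabilityMeasure_coordLaw hα'
  have hmean := h.isEquivPair.integral_logLR_eq_zero hα
  rw [h.law_tilted hα', integral_congr_ae (h.logLR_prodDensity hα'),
    integral_finsetSum _ fun j _ => integrable_comp_eval (μ := coordLaw μ φ α)
      ((h.isEquivPair_coord j).integrable_logLR hα.1)] at hmean
  filter_upwards [h.logLR_prodDensity hα'] with x hx
  have e : ∀ j, ∫ x, logLR (φ 0 j) (φ 1 j) (x j) ∂(Measure.pi (coordLaw μ φ α))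
      = ∫ y, logLR (φ 0 j) (φ 1 j) y ∂(coordLaw μ φ α j) := fun j =>
    integral_comp_eval (h.isEquivPair_coord j).measurable_logLR.aestronglyMeasurable
  simp only [e] at hmean
  rw [hx]
  simp only [coordZ, centredLLR, Finset.sum_sub_distrib]
  simp only [coordLaw] at hmean
  rw [hmean, sub_zero]

theorem sq_sqrt_mul_sigmaBar (h : InFamily μ φ) (hα : α ∈ Set.Ioo (0 : ℝ) 1) :
    (√n * sigmaBar μ φ α) ^ 2 = ∑ j, ∫ y, coordZ μ φ α j y ^ 2 ∂(coordLaw μ φ α j) := by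
  have hv : ∀ j, ProbabilityTheory.variance (coordZ μ φ α j) (coordLaw μ φ α j)
      = ∫ y, coordZ μ φ α j y ^ 2 ∂(coordLaw μ φ α j) := by
    intro j
    rw [ProbabilityTheory.variance_eq_integral (h.measurable_coordZ α j).aemeasurable]
    have : ∫ x, coordZ μ φ α j x ∂(coordLaw μ φ α j) = 0 :=
      (h.isEquivPair_coord j).integral_centredLLR hα
    simp [this]
  rcases Nat.eq_zero_or_pos n with rfl | hn
  · simp
  have hn' : (0 : ℝ) < n := Nat.cast_pos.2 hn
  rw [sigmaBar, mul_pow, Real.sq_sqrt hn'.le, Real.sq_sqrt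
    (mul_nonneg (by positivity) (Finset.sum_nonneg fun j _ => ProbabilityTheory.variance_nonneg _ _)),
    ← mul_assoc, mul_one_div_cancel hn'.ne', one_mul]
  exact Finset.sum_congr rfl fun j _ => hv j

/-- Zero variance would make the log-likelihood ratio vanish almost surely, hence the two densities
equal, against positive divergence. This also excludes n = 0. -/
theorem sqrt_mul_sigmaBar_pos (h : InFamily μ φ)
    (hα : IsChernoffArgmax (Measure.pi μ) (prodDensity φ 0) (prodDensity φ 1) α) :
    0 < √n * sigmaBar μ φ α := by
  have hα' := Set.Ioo_subset_Icc_self hα.1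
  have hp := h.isProbabilityMeasure_coordLaw hα'
  refine lt_of_le_of_ne (mul_nonneg (Real.sqrt_nonneg _) (Real.sqrt_nonneg _)) fun h0 => ?_
  refine h.not_ae_eq ?_
  have hsq := h.sq_sqrt_mul_sigmaBar hα.1
  rw [← h0, zero_pow two_ne_zero, eq_comm,
    Finset.sum_eq_zero_iff_of_nonneg fun j _ => integral_nonneg fun y => sq_nonneg _] at hsq
  have hZ : ∀ j, ∀ᵐ y ∂(coordLaw μ φ α j), coordZ μ φ α j y = 0 := by
    intro j
    have := hsq j (Finset.mem_univ j)
    rw [integral_eq_zero_iff_of_nonneg (fun y => sq_nonneg _)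
      (integrable_sq_of_cube (Q := coordLaw μ φ α j) (h.measurable_coordZ α j)
        ((h.isEquivPair_coord j).integrable_abs_centredLLR_cube hα.1))] at this
    filter_upwards [this] with y hy
    exact pow_eq_zero_iff two_ne_zero |>.1 hy
  have hZ' : ∀ᵐ x ∂(Measure.pi (coordLaw μ φ α)), ∀ j, coordZ μ φ α j (x j) = 0 :=
    ae_all_iff.2 fun j =>
      (measurePreserving_eval (coordLaw μ φ α) j).quasiMeasurePreserving.ae (hZ j)
  have hE := h.isEquivPair
  have hlog : ∀ᵐ x ∂(law (Measure.pi μ)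
      (tilted (Measure.pi μ) (prodDensity φ 0) (prodDensity φ 1) α)),
      prodDensity φ 0 x = prodDensity φ 1 x := by
    have hpos := hE.ae_tilted_pos α
    rw [h.law_tilted hα'] at hpos ⊢
    filter_upwards [hpos, hZ', h.logLR_ae_eq_sum_coordZ hα] with x hx hx0 hxl
    rw [Finset.sum_eq_zero fun j _ => hx0 j] at hxl
    have := Real.eq_one_of_pos_of_log_eq_zero (div_pos hx.1 hx.2) hxl
    rwa [div_eq_one_iff_eq hx.2.ne'] at this
  rw [ae_law_iff (hE.measurable_tilted α) (hE.tilted_nonneg α)] at hlog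
  filter_upwards [hlog, hE.tilted_ae_ne_zero α, hE.ae_zero_iff] with x h1 h2 h3
  by_cases hf : prodDensity φ 0 x = 0
  · rw [hf, h3.1 hf]
  · exact h1 (h2 hf)

theorem expG_eq (h : InFamily μ φ)
    (hα : IsChernoffArgmax (Measure.pi μ) (prodDensity φ 0) (prodDensity φ 1) α) :
    expG μ φ α = ∫ x, gFun α x ∂((Measure.pi (coordLaw μ φ α)).map
      fun x => ∑ j, coordZ μ φ α j (x j)) := by
  have hm : Measurable fun x : (j : Fin n) → Ω j => ∑ j, coordZ μ φ α j (x j) :=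
    Finset.measurable_sum _ fun j _ => (h.measurable_coordZ α j).comp (measurable_pi_apply j)
  rw [expG, h.law_tilted (Set.Ioo_subset_Icc_self hα.1), integral_map hm.aemeasurable
    (continuous_gFun α).aestronglyMeasurable]
  exact integral_congr_ae ((h.logLR_ae_eq_sum_coordZ hα).mono fun x hx => by simp only [hx])

theorem affinity_eq (h : InFamily μ φ)
    (hα : IsChernoffArgmax (Measure.pi μ) (prodDensity φ 0) (prodDensity φ 1) α) :
    affinity (Measure.pi μ) (prodDensity φ 0) (prodDensity φ 1) = expG μ φ α
      * Real.exp (-chernoffInfo (Measure.pi μ) (prodDensity φ 0) (prodDensity φ 1)) := by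
  rw [IsEquivPair.chernoffInfo_eq hα, h.isEquivPair.affinity_eq α]
  rfl

end InFamily

end BayesChernoff

/-! ### Choice of constants and conclusion. -/

open MeasureTheory BayesChernoff
theorem theorem1 (C₁ : ℝ) :
    ∃ C₂ C₃ C₄ : ℝ, 0 < C₂ ∧ 0 < C₃ ∧ 0 < C₄ ∧
      ∀ (n : ℕ) (Ω : Fin n → Type*) [∀ j, MeasurableSpace (Ω j)]
        (μ : (j : Fin n) → Measure (Ω j)) [∀ j, SigmaFinite (μ j)]
        (φ : Fin 2 → (j : Fin n) → Ω j → ℝ),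
        InFamily μ φ →
        (∃! α : ℝ, IsChernoffArgmax (Measure.pi μ) (prodDensity φ 0) (prodDensity φ 1) α) ∧
        (∀ zhat : ((j : Fin n) → Ω j) → Fin 2, IsBayesEstimator (prodDensity φ) zhat →
          affinity (Measure.pi μ) (prodDensity φ 0) (prodDensity φ 1)
            = 2 * errorProb (Measure.pi μ) (prodDensity φ) zhat) ∧
        ∀ α : ℝ, IsChernoffArgmax (Measure.pi μ) (prodDensity φ 0) (prodDensity φ 1) α →
          ∑ j, ∫ y, |coordZ μ φ α j y| ^ 3 ∂(coordLaw μ φ α j)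
            ≤ C₁ * n * sigmaBar μ φ α ^ 2 →
          (expG μ φ α ≤ C₂ / (Real.sqrt n * sigmaBar μ φ α * (1 - α) * α) ∧
            affinity (Measure.pi μ) (prodDensity φ 0) (prodDensity φ 1)
              ≤ C₂ / (Real.sqrt n * sigmaBar μ φ α * (1 - α) * α) *
                Real.exp (-chernoffInfo (Measure.pi μ) (prodDensity φ 0) (prodDensity φ 1))) ∧
          (C₃ ≤ Real.sqrt n * sigmaBar μ φ α * (1 - α) * α →
            C₄ / (Real.sqrt n * sigmaBar μ φ α * (1 - α) * α) ≤ expG μ φ α ∧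
            C₄ / (Real.sqrt n * sigmaBar μ φ α * (1 - α) * α) *
                Real.exp (-chernoffInfo (Measure.pi μ) (prodDensity φ 0) (prodDensity φ 1))
              ≤ affinity (Measure.pi μ) (prodDensity φ 0) (prodDensity φ 1)) := by
  -- Enlarging C₁ only weakens the moment condition; C ≥ 1 makes the frequency cutoff T₀ = 1/(16C)
  -- positive and at most 1.
  obtain ⟨C, hC1, hC⟩ : ∃ C : ℝ, C₁ ≤ C ∧ 1 ≤ C := ⟨max C₁ 1, le_max_left _ _, le_max_right _ _⟩
  have hC0 : 0 < C := by linarith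
  have hT₀ : 0 < 1 / (16 * C) := by positivity
  have hT₁ : 1 / (16 * C) ≤ 1 := by
    rw [div_le_one (by positivity)]; linarith
  refine ⟨32 / (1 / (16 * C)), max (6400 * (5 * C)) (4 * (2880 / (1 / (16 * C)))),
    Real.exp (-(4 * (2880 / (1 / (16 * C))))) * (72 / 2880 ^ 2 * (2880 / (1 / (16 * C)))),
    by positivity, by positivity, by positivity, ?_⟩
  intro n Ω _ μ _ φ h
  refine ⟨h.isEquivPair.existsUnique_isChernoffArgmax h.not_ae_eq,
    fun zhat hz => affinity_eq_two_mul_errorProb h.isDensity_prodDensity hz, ?_⟩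
  intro α hα hρ
  have hp := h.isProbabilityMeasure_coordLaw (Set.Ioo_subset_Icc_self hα.1)
  have hs := h.sqrt_mul_sigmaBar_pos hα
  have hs2 := h.sq_sqrt_mul_sigmaBar hα.1
  have hρ' : ∑ j, ∫ y, |coordZ μ φ α j y| ^ 3 ∂(coordLaw μ φ α j)
      ≤ C * (√n * sigmaBar μ φ α) ^ 2 := by
    refine hρ.trans ?_
    rw [mul_pow, Real.sq_sqrt (Nat.cast_nonneg n), mul_assoc]
    gcongr
  have hZm := h.measurable_coordZ α
  have hZ3 : ∀ j, Integrable (fun y => |coordZ μ φ α j y| ^ 3) (coordLaw μ φ α j) := fun j =>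
    (h.isEquivPair_coord j).integrable_abs_centredLLR_cube hα.1
  have hZ0 : ∀ j, ∫ y, coordZ μ φ α j y ∂(coordLaw μ φ α j) = 0 := fun j =>
    (h.isEquivPair_coord j).integral_centredLLR hα.1
  have hν := norm_charFun_map_sum_le hZm hZ3 hZ0 hs2 hC0 hρ'
  have hν' := norm_charFun_map_sum_sub_le hZm hZ3 hZ0 hs2 hρ'
  have hm : Measurable fun x : (j : Fin n) → Ω j => ∑ j, coordZ μ φ α j (x j) :=
    Finset.measurable_sum _ fun j _ => (hZm j).comp (measurable_pi_apply j)
  have := Measure.isProbabilityMeasure_map (μ := Measure.pi (coordLaw μ φ α)) hm.aemeasurable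
  have hexp := (Real.exp_pos
    (-chernoffInfo (Measure.pi μ) (prodDensity φ 0) (prodDensity φ 1))).le
  have hup := integral_gFun_le hs hT₀ hT₁ hα.1 hν
  rw [← h.expG_eq hα] at hup
  rw [h.affinity_eq hα]
  refine ⟨⟨hup, mul_le_mul_of_nonneg_right hup hexp⟩, fun hC₃ => ?_⟩
  have hlow := le_integral_gFun (by positivity) hT₀ hα.1 hν hν'
    ((le_max_left _ _).trans hC₃) ((le_max_right _ _).trans hC₃)
  rw [← h.expG_eq hα] at hlow
  exact ⟨hlow, mul_le_mul_of_nonneg_right hlow hexp⟩
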